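/- **Corollary 2.2 (strong maximum principle, elliptic).** Let $n\ge 2$, let $\Omega\subset\mathbb R^n$ be a domain (a nonempty connected open set), and consider $$\mathcal L u\equiv -D_i\big(a_{ij}(x)D_ju\big)+b_i(x)D_iu$$ in $\Omega$, with summation over repeated indices. Here the $a_{ij}$ are measurable and locally bounded in $\Omega$ (i.e. $a_{ij}\in L_{\infty,loc}(\Omega)$; this follows from the ellipticity condition when $(a_{ij})$ is measurable and symmetric), and for some constant $\nu>0$ $$\nu|\xi|^2\le a_{ij}(x)\xi_i\xi_j\le\nu^{-1}|\xi|^2\qquad\text{for all }\xi\in\mathbb R^n\text{ and almost all }x\in\Omega .$$ Let $\mathbf b=(b_i)\in L_{q,loc}(\Omega)$ for some $\frac n2<q\le n$, and let $\operatorname{div}\mathbf b\le 0$ in $\Omega$ in the sense of distributions, i.e. $\int_\Omega b_iD_i\varphi\,dx\ge0$ for every $\varphi\in C_c^\infty(\Omega)$ with $\varphi\ge0$. Let $V$ be a Lipschitz supersolution of $\mathcal LV=0$ in $\Omega$, i.e. $V$ is Lipschitz on $\Omega$ and $$\int_\Omega\big(a_{ij}D_jV\,D_i\eta+b_iD_iV\,\eta\big)\,dx\ge0$$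 for every Lipschitz function $\eta\ge0$ with compact support in $\Omega$. If $V$ is not constant on $\Omega$, then $V$ does not attain its minimum over $\Omega$ at any point of $\Omega$: there is no $x_0\in\Omega$ with $V(x_0)\le V(x)$ for all $x\in\Omega$. -/

import Mathlib

open MeasureTheory

/-- The partial derivative `D_i f (x)` of `f : ℝⁿ → ℝ`. A Lipschitz function on an open set is
differentiable almost everywhere there, and this is then its weak derivative. -/
noncomputable def partialD {n : ℕ} (i : Fin n) (f : EuclideanSpace ℝ (Fin n) → ℝ)
    (x : EuclideanSpace ℝ (Fin n)) : ℝ :=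
  fderiv ℝ f x (EuclideanSpace.single i 1)

/-- `f ∈ L_{p,loc}(Ω)`: `f` is in `L_p(K)` for every compact `K ⊆ Ω`. -/
def MemLpLoc {n : ℕ} {F : Type*} [NormedAddCommGroup F] (f : EuclideanSpace ℝ (Fin n) → F)
    (p : ENNReal) (Ω : Set (EuclideanSpace ℝ (Fin n))) : Prop :=
  ∀ K : Set (EuclideanSpace ℝ (Fin n)), IsCompact K → K ⊆ Ω → MemLp f p (volume.restrict K)

/-- Uniform ellipticity with constant `ν`:
`ν |ξ|² ≤ a_ij(x) ξ_i ξ_j ≤ ν⁻¹ |ξ|²` for all `ξ`, for almost every `x ∈ Ω`. -/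
def UniformlyElliptic {n : ℕ} (ν : ℝ)
    (a : EuclideanSpace ℝ (Fin n) → Matrix (Fin n) (Fin n) ℝ)
    (Ω : Set (EuclideanSpace ℝ (Fin n))) : Prop :=
  ∀ᵐ x ∂(volume.restrict Ω), ∀ ξ : EuclideanSpace ℝ (Fin n),
    ν * ‖ξ‖ ^ 2 ≤ ∑ i, ∑ j, a x i j * ξ i * ξ j ∧
      ∑ i, ∑ j, a x i j * ξ i * ξ j ≤ ν⁻¹ * ‖ξ‖ ^ 2

/-- `div b ≤ 0` in `Ω` in the sense of distributions: `-∫ b · Dφ ≤ 0` for every nonnegative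
`φ ∈ C_c^∞(Ω)`. -/
def DivNonposDistrib {n : ℕ} (b : EuclideanSpace ℝ (Fin n) → EuclideanSpace ℝ (Fin n))
    (Ω : Set (EuclideanSpace ℝ (Fin n))) : Prop :=
  ∀ φ : EuclideanSpace ℝ (Fin n) → ℝ, ContDiff ℝ (⊤ : ℕ∞) φ → HasCompactSupport φ →
    tsupport φ ⊆ Ω → (∀ x, 0 ≤ φ x) →
      -(∫ x in Ω, ∑ i, b x i * partialD i φ x) ≤ 0

/-- `V` is a Lipschitz supersolution in `Ω` of `-D_i(a_ij D_j V) + b_i D_i V = 0`: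
`V` is Lipschitz on `Ω` and `∫_Ω (a_ij D_j V D_i η + b_i D_i V η) dx ≥ 0` for every nonnegative
Lipschitz function `η` with compact support in `Ω`. -/
def IsLipschitzSupersolution {n : ℕ}
    (a : EuclideanSpace ℝ (Fin n) → Matrix (Fin n) (Fin n) ℝ)
    (b : EuclideanSpace ℝ (Fin n) → EuclideanSpace ℝ (Fin n))
    (Ω : Set (EuclideanSpace ℝ (Fin n))) (V : EuclideanSpace ℝ (Fin n) → ℝ) : Prop :=
  (∃ C : NNReal, LipschitzOnWith C V Ω) ∧
  ∀ η : EuclideanSpace ℝ (Fin n) → ℝ, (∃ C : NNReal, LipschitzWith C η) →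
    HasCompactSupport η → tsupport η ⊆ Ω → (∀ x, 0 ≤ η x) →
      0 ≤ ∫ x in Ω, ((∑ i, ∑ j, a x i j * partialD j V x * partialD i η x) +
        ∑ i, b x i * partialD i V x * η x)

/-! If `V` attains its minimum at `x₀`, then `u = V - V x₀` is a nonnegative supersolution. Its zero
set is closed in the connected set `Ω`, so it suffices that it be open: a nonnegative supersolution
vanishing at a point vanishes near it. This local claim follows from De Giorgi's method, with
truncations `v = (k - u)₊`.

Energy (`exists_energy_bound`). The supersolution is tested with `v φ²`. The drift then contributes
`-½ φ² b · D(v²)`, and `div b ≤ 0` tested with `(v φ)²` moves the derivative onto `φ`. Only `v² φ b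
· Dφ` remains, and Hölder's inequality bounds its integral by a multiple of the power `1 - 1/q` of
the measure of `{u < k}`.

Pointwise bound (`exists_pos_forall_half_le`). Combined with the `L¹` Sobolev inequality on
shrinking balls and levels, the energy bound gives a recursion for the measures of sublevel sets
with exponent `(1 - 1/(2q)) · n/(n-1)`. It exceeds `1` exactly when `q > n/2`. Hence there is `ε`,
independent of `k`, such that `u ≥ k/2` at the centre whenever `{u < k}` has measure at most `ε` in
the ball.

Small sublevel sets (`exists_sublevel_small`). If `u ≥ k₀ > 0` on a set of positive measure, an
isoperimetric inequality bounds `k |{u < k/2}|` by the integral of `|Du|` over `{k/2 < u < k}`, and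
the energy bound makes this at most a constant times `k |{0 < u < k}|^{1/2}`. The factor `k`
cancels, and the sets `{0 < u < k}` shrink to the empty set as `k → 0`.

Together: if `u` were not identically zero near `x₀`, some `{u < k}` would have measure at most `ε`,
so `u x₀ ≥ k/2 > 0`. -/

open Filter Topology Metric Set
open scoped ENNReal NNReal Convolution

/-! ### Mollification, and Sobolev and isoperimetric inequalities for Lipschitz functions -/

section Mollification

variable {E : Type*} [NormedAddCommGroup E] [InnerProductSpace ℝ E] [FiniteDimensional ℝ E]
  [MeasurableSpace E] [BorelSpace E]

/-- Differentiation under the integral, with the derivative falling on `f` rather than on the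
kernel: Rademacher's theorem gives it almost everywhere, and the Lipschitz bound dominates the
difference quotients. Bounds and limits for gradients of mollifications are read off from this form.
-/
theorem hasFDerivAt_normed_convolution_of_lipschitz (φ : ContDiffBump (0 : E)) {f : E → ℝ}
    {C : ℝ≥0} (hf : LipschitzWith C f) (x : E) :
    HasFDerivAt (φ.normed volume ⋆[ContinuousLinearMap.lsmul ℝ ℝ, volume] f)
      ((φ.normed volume ⋆[ContinuousLinearMap.lsmul ℝ ℝ, volume] (fderiv ℝ f)) x) x := by
  have hφi : Integrable (φ.normed (volume : Measure E)) := φ.integrable_normed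
  have hmeas : ∀ y, AEStronglyMeasurable (fun t => φ.normed volume t * f (y - t)) volume :=
    fun y => (φ.continuous_normed.mul
      (hf.continuous.comp (continuous_const.sub continuous_id))).aestronglyMeasurable
  have hd : ∀ᵐ t ∂(volume : Measure E), DifferentiableAt ℝ f (x - t) :=
    (quasiMeasurePreserving_sub_left volume x).ae hf.ae_differentiableAt
  have key := hasFDerivAt_integral_of_dominated_loc_of_lip' (μ := (volume : Measure E))
    (F := fun y t => φ.normed volume t * f (y - t))
    (F' := fun t => φ.normed volume t • fderiv ℝ f (x - t)) (x₀ := x) (s := univ)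
    (bound := fun t => φ.normed volume t * C) univ_mem (fun y _ => hmeas y) ?_ ?_ ?_ ?_ ?_
  · exact key.2
  · exact ((φ.continuous_normed.mul
      (hf.continuous.comp (continuous_const.sub continuous_id))).integrable_of_hasCompactSupport
      φ.hasCompactSupport_normed.mul_right)
  · exact φ.continuous_normed.aestronglyMeasurable.smul
      (((measurable_fderiv ℝ f).comp (measurable_const.sub measurable_id)).aestronglyMeasurable)
  · refine Eventually.of_forall fun t y _ => ?_
    rw [← mul_sub, norm_mul, Real.norm_of_nonneg (φ.nonneg_normed t), mul_assoc]
    refine mul_le_mul_of_nonneg_left ?_ (φ.nonneg_normed t)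
    have := hf.dist_le_mul (y - t) (x - t)
    simpa [dist_eq_norm] using this
  · exact hφi.mul_const _
  · filter_upwards [hd] with t ht
    have h1 : HasFDerivAt (fun y => f (y - t)) (fderiv ℝ f (x - t)) x := by
      have := HasFDerivAt.comp x (f := fun y => y - t) (g := f) ht.hasFDerivAt
        ((hasFDerivAt_id x).sub_const t)
      rwa [ContinuousLinearMap.comp_id] at this
    exact h1.const_smul (φ.normed volume t)

/-- Mollification of a Lipschitz function. -/
theorem LipschitzWith.exists_contDiff_approx {f : E → ℝ} {C : ℝ≥0} (hf : LipschitzWith C f) :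
    ∃ g : ℕ → E → ℝ, (∀ k, ContDiff ℝ (⊤ : ℕ∞) (g k)) ∧
      (∀ x, Tendsto (fun k => g k x) atTop (𝓝 (f x))) ∧
      (∀ k x, ‖fderiv ℝ (g k) x‖ ≤ C) ∧
      (∀ᵐ x, Tendsto (fun k => fderiv ℝ (g k) x) atTop (𝓝 (fderiv ℝ f x))) ∧
      ((∀ x, 0 ≤ f x) → ∀ k x, 0 ≤ g k x) ∧
      (∀ k, tsupport (g k) ⊆ cthickening (1 / ((k : ℝ) + 1)) (tsupport f)) ∧
      (∀ k, ∫⁻ x, ‖fderiv ℝ (g k) x‖ₑ ≤ ∫⁻ x, ‖fderiv ℝ f x‖ₑ) := by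
  have hpos : ∀ k : ℕ, 0 < 1 / ((k : ℝ) + 1) := fun k => by positivity
  let φ : ℕ → ContDiffBump (0 : E) := fun k =>
    ⟨1 / ((k : ℝ) + 1) / 2, 1 / ((k : ℝ) + 1), half_pos (hpos k), half_lt_self (hpos k)⟩
  have hout : Tendsto (fun k => (φ k).rOut) atTop (𝓝 0) := tendsto_one_div_add_atTop_nhds_zero_nat
  have hfm : Measurable (fderiv ℝ f) := measurable_fderiv ℝ f
  have hfl : LocallyIntegrable (fderiv ℝ f) (volume : Measure E) := by
    refine (locallyIntegrable_const (C : ℝ)).mono hfm.aestronglyMeasurable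
      (Eventually.of_forall fun x => ?_)
    simpa using norm_fderiv_le_of_lipschitz ℝ hf
  have hder : ∀ k x, fderiv ℝ ((φ k).normed volume ⋆[ContinuousLinearMap.lsmul ℝ ℝ, volume] f) x =
      ((φ k).normed volume ⋆[ContinuousLinearMap.lsmul ℝ ℝ, volume] (fderiv ℝ f)) x :=
    fun k x => (hasFDerivAt_normed_convolution_of_lipschitz (φ k) hf x).fderiv
  refine ⟨fun k => (φ k).normed volume ⋆[ContinuousLinearMap.lsmul ℝ ℝ, volume] f, ?_, ?_, ?_, ?_,
    ?_, ?_, ?_⟩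
  · intro k
    exact (φ k).hasCompactSupport_normed.contDiff_convolution_left _ (φ k).contDiff_normed
      hf.continuous.locallyIntegrable
  · exact ContDiffBump.convolution_tendsto_right_of_continuous hout hf.continuous
  · intro k x
    rw [hder]
    refine (norm_integral_le_of_norm_le (g := fun t => (φ k).normed volume t * C)
      ((φ k).integrable_normed.mul_const _) (Eventually.of_forall fun t => ?_)).trans ?_
    · simp only [ContinuousLinearMap.lsmul_apply, norm_smul]
      rw [Real.norm_of_nonneg ((φ k).nonneg_normed t)]
      exact mul_le_mul_of_nonneg_left (norm_fderiv_le_of_lipschitz ℝ hf) ((φ k).nonneg_normed t)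
    · rw [integral_mul_const, (φ k).integral_normed, one_mul]
  · simp only [hder]
    -- The outer radius of each bump is twice the inner one; a bounded ratio is what Lebesgue
    -- differentiation needs here.
    refine ContDiffBump.ae_convolution_tendsto_right_of_locallyIntegrable (K := 2) hout
      (Eventually.of_forall fun k => ?_) hfl
    change 1 / ((k : ℝ) + 1) ≤ 2 * (1 / ((k : ℝ) + 1) / 2)
    linarith
  · intro h0 k x
    exact integral_nonneg fun t => mul_nonneg ((φ k).nonneg_normed t) (h0 _)
  · intro k
    refine closure_minimal (fun x hx => ?_) isClosed_cthickening
    obtain ⟨a, ha, c, hc, rfl⟩ := (support_convolution_subset _).trans Subset.rfl hx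
    rw [(φ k).support_normed_eq] at ha
    refine mem_cthickening_of_dist_le _ c _ _ (subset_closure hc) ?_
    have : ‖a‖ < 1 / ((k : ℝ) + 1) := mem_ball_zero_iff.1 ha
    simpa [dist_eq_norm] using this.le
  · intro k
    simp only [hder]
    have h1 : ∀ x, ‖((φ k).normed volume ⋆[ContinuousLinearMap.lsmul ℝ ℝ, volume]
        (fderiv ℝ f)) x‖ₑ ≤ ∫⁻ t, ‖(φ k).normed volume t‖ₑ * ‖fderiv ℝ f (x - t)‖ₑ := by
      intro x
      refine (enorm_integral_le_lintegral_enorm _).trans (le_of_eq ?_)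
      simp [enorm_smul]
    refine (lintegral_mono h1).trans ?_
    have hm : Measurable fun p : E × E => ‖(φ k).normed volume p.2‖ₑ * ‖fderiv ℝ f (p.1 - p.2)‖ₑ :=
      (((φ k).continuous_normed.measurable.comp measurable_snd).enorm).mul
        ((hfm.comp (measurable_fst.sub measurable_snd)).enorm)
    rw [lintegral_lintegral_swap hm.aemeasurable]
    have h2 : ∀ t, ∫⁻ x, ‖(φ k).normed volume t‖ₑ * ‖fderiv ℝ f (x - t)‖ₑ =
        ‖(φ k).normed volume t‖ₑ * ∫⁻ x, ‖fderiv ℝ f x‖ₑ := by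
      intro t
      rw [lintegral_const_mul' _ _ enorm_ne_top,
        lintegral_sub_right_eq_self (fun x => ‖fderiv ℝ f x‖ₑ) t]
    simp only [h2]
    rw [lintegral_mul_const _ ((φ k).continuous_normed.measurable.enorm)]
    have h3 : ∫⁻ t, ‖(φ k).normed (volume : Measure E) t‖ₑ = 1 := by
      rw [← ofReal_integral_norm_eq_lintegral_enorm (φ k).integrable_normed]
      simp_rw [Real.norm_of_nonneg ((φ k).nonneg_normed _)]
      rw [(φ k).integral_normed, ENNReal.ofReal_one]
    rw [h3, one_mul]

/-- The Gagliardo–Nirenberg–Sobolev inequality for compactly supported Lipschitz functions. -/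
theorem LipschitzWith.lintegral_pow_le_pow_lintegral_fderiv {f : E → ℝ} {C : ℝ≥0}
    (hf : LipschitzWith C f) (hfc : HasCompactSupport f) {p : ℝ}
    (hp : Real.HolderConjugate (Module.finrank ℝ E) p) :
    ∫⁻ x, ‖f x‖ₑ ^ p ≤
      lintegralPowLePowLIntegralFDerivConst (volume : Measure E) p *
        (∫⁻ x, ‖fderiv ℝ f x‖ₑ) ^ p := by
  obtain ⟨g, hg, hgt, -, -, -, hgs, hgi⟩ := hf.exists_contDiff_approx
  have hlim : ∀ x, liminf (fun k => ‖g k x‖ₑ ^ p) atTop = ‖f x‖ₑ ^ p := fun x =>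
    ((ENNReal.continuous_rpow_const.tendsto _).comp (hgt x).enorm).liminf_eq
  calc ∫⁻ x, ‖f x‖ₑ ^ p = ∫⁻ x, liminf (fun k => ‖g k x‖ₑ ^ p) atTop := by simp_rw [hlim]
    _ ≤ liminf (fun k => ∫⁻ x, ‖g k x‖ₑ ^ p) atTop :=
        lintegral_liminf_le fun k => ((hg k).continuous.measurable.enorm.pow_const p)
    _ ≤ _ := by
        refine liminf_le_of_frequently_le' (Eventually.frequently (Eventually.of_forall fun k => ?_))
        have hc : HasCompactSupport (g k) :=
          (hfc.isCompact.cthickening).of_isClosed_subset (isClosed_tsupport _) (hgs k)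
        refine (MeasureTheory.lintegral_pow_le_pow_lintegral_fderiv volume
          ((hg k).of_le (by norm_cast)) hc hp).trans ?_
        exact mul_le_mul_right (ENNReal.rpow_le_rpow (hgi k) hp.symm.nonneg) _

/-- The increment is the integral of the derivative along the segment from `x` to `x + h`; after
Tonelli, each translate of the ball by `t • h` stays in the ball enlarged by `‖h‖`. -/
theorem ContDiff.lintegral_ball_enorm_add_sub_le {g : E → ℝ} (hg : ContDiff ℝ 1 g)
    (x₀ h : E) (r : ℝ) :
    ∫⁻ x in ball x₀ r, ‖g (x + h) - g x‖ₑ ≤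
      ‖h‖ₑ * ∫⁻ x in ball x₀ (r + ‖h‖), ‖fderiv ℝ g x‖ₑ := by
  have hc : Continuous (fderiv ℝ g) := hg.continuous_fderiv one_ne_zero
  have h1 : ∀ x, ‖g (x + h) - g x‖ₑ ≤
      ∫⁻ t in Ioc (0 : ℝ) 1, ‖h‖ₑ * ‖fderiv ℝ g (x + t • h)‖ₑ := by
    intro x
    have hd : ∀ t : ℝ, HasDerivAt (fun t : ℝ => g (x + t • h)) (fderiv ℝ g (x + t • h) h) t := by
      intro t
      have h2 : HasDerivAt (fun t : ℝ => x + t • h) h t := by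
        simpa using ((hasDerivAt_id t).smul_const h).const_add x
      exact ((hg.differentiable one_ne_zero _).hasFDerivAt).comp_hasDerivAt t h2
    have hcont : Continuous fun t : ℝ => fderiv ℝ g (x + t • h) h :=
      (hc.comp (by fun_prop)).clm_apply continuous_const
    have h3 := intervalIntegral.integral_eq_sub_of_hasDerivAt (a := 0) (b := 1)
      (fun t _ => hd t) (hcont.intervalIntegrable _ _)
    simp only [one_smul, zero_smul, add_zero] at h3
    rw [← h3, intervalIntegral.integral_of_le zero_le_one]
    refine (enorm_integral_le_lintegral_enorm _).trans (lintegral_mono fun t => ?_)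
    rw [mul_comm]
    exact ContinuousLinearMap.le_opENorm _ _
  refine (lintegral_mono h1).trans ?_
  have hm : Measurable fun p : E × ℝ => ‖h‖ₑ * ‖fderiv ℝ g (p.1 + p.2 • h)‖ₑ :=
    (((hc.comp (by fun_prop : Continuous fun p : E × ℝ => p.1 + p.2 • h)).measurable).enorm).const_mul _
  rw [lintegral_lintegral_swap hm.aemeasurable]
  have h4 : ∀ t ∈ Ioc (0 : ℝ) 1, ∫⁻ x in ball x₀ r, ‖h‖ₑ * ‖fderiv ℝ g (x + t • h)‖ₑ ≤
      ‖h‖ₑ * ∫⁻ x in ball x₀ (r + ‖h‖), ‖fderiv ℝ g x‖ₑ := by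
    intro t ht
    rw [lintegral_const_mul' _ _ enorm_ne_top]
    refine mul_le_mul_right ?_ _
    rw [← lintegral_indicator measurableSet_ball, ← lintegral_indicator measurableSet_ball,
      ← lintegral_add_right_eq_self
        ((ball x₀ (r + ‖h‖)).indicator fun x => ‖fderiv ℝ g x‖ₑ) (t • h)]
    refine lintegral_mono fun x => ?_
    by_cases hx : x ∈ ball x₀ r
    · have : x + t • h ∈ ball x₀ (r + ‖h‖) := by
        rw [mem_ball, dist_eq_norm] at hx ⊢
        have h5 : ‖t • h‖ ≤ ‖h‖ := by
          rw [norm_smul, Real.norm_of_nonneg ht.1.le]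
          exact mul_le_of_le_one_left (norm_nonneg _) ht.2
        calc ‖x + t • h - x₀‖ = ‖(x - x₀) + t • h‖ := by congr 1; abel
          _ ≤ ‖x - x₀‖ + ‖t • h‖ := norm_add_le _ _
          _ < r + ‖h‖ := by linarith
      simp [hx, this]
    · simp [hx]
  refine (setLIntegral_mono' measurableSet_Ioc h4).trans ?_
  simp

/-- Mollification reduces to the smooth case: Fatou on the left, dominated convergence of the
gradients on the right, with the Lipschitz constant as majorant on a ball. -/
theorem LipschitzWith.lintegral_ball_enorm_add_sub_le {f : E → ℝ} {C : ℝ≥0}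
    (hf : LipschitzWith C f) (x₀ h : E) (r : ℝ) :
    ∫⁻ x in ball x₀ r, ‖f (x + h) - f x‖ₑ ≤
      ‖h‖ₑ * ∫⁻ x in ball x₀ (r + ‖h‖), ‖fderiv ℝ f x‖ₑ := by
  obtain ⟨g, hg, hgt, hgb, hga, -, -, -⟩ := hf.exists_contDiff_approx
  have hg1 : ∀ k, ContDiff ℝ 1 (g k) := fun k => (hg k).of_le (by norm_cast)
  have hlim : ∀ x, liminf (fun k => ‖g k (x + h) - g k x‖ₑ) atTop = ‖f (x + h) - f x‖ₑ := fun x =>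
    (((hgt _).sub (hgt x)).enorm).liminf_eq
  have hright : Tendsto (fun k => ‖h‖ₑ * ∫⁻ x in ball x₀ (r + ‖h‖), ‖fderiv ℝ (g k) x‖ₑ) atTop
      (𝓝 (‖h‖ₑ * ∫⁻ x in ball x₀ (r + ‖h‖), ‖fderiv ℝ f x‖ₑ)) := by
    refine ENNReal.Tendsto.const_mul ?_ (Or.inr enorm_ne_top)
    refine tendsto_lintegral_of_dominated_convergence (fun _ => (C : ℝ≥0∞))
      (fun k => (measurable_fderiv ℝ (g k)).enorm) (fun k => Eventually.of_forall fun x => ?_) ?_ ?_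
    · change ‖fderiv ℝ (g k) x‖ₑ ≤ C
      rw [← ofReal_norm]
      exact ENNReal.ofReal_le_of_le_toReal (by simpa using hgb k x)
    · simpa using ENNReal.mul_ne_top ENNReal.coe_ne_top measure_ball_lt_top.ne
    · exact (ae_restrict_of_ae hga).mono fun x hx => hx.enorm
  calc ∫⁻ x in ball x₀ r, ‖f (x + h) - f x‖ₑ
      = ∫⁻ x in ball x₀ r, liminf (fun k => ‖g k (x + h) - g k x‖ₑ) atTop := by simp_rw [hlim]
    _ ≤ liminf (fun k => ∫⁻ x in ball x₀ r, ‖g k (x + h) - g k x‖ₑ) atTop :=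
        lintegral_liminf_le fun k => by
          have := (hg k).continuous
          exact (by fun_prop : Continuous fun x => g k (x + h) - g k x).measurable.enorm
    _ ≤ liminf (fun k => ‖h‖ₑ * ∫⁻ x in ball x₀ (r + ‖h‖), ‖fderiv ℝ (g k) x‖ₑ) atTop :=
        liminf_le_liminf (Eventually.of_forall fun k =>
          (hg1 k).lintegral_ball_enorm_add_sub_le x₀ h r)
    _ = _ := hright.liminf_eq

/-- A De Giorgi isoperimetric inequality: the product of the measures of a sublevel and of a
superlevel set is controlled by the gradient. -/
theorem LipschitzWith.mul_volume_mul_volume_le {f : E → ℝ} {C : ℝ≥0} (hf : LipschitzWith C f)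
    (x₀ : E) (r H : ℝ) :
    ENNReal.ofReal H * (volume (ball x₀ r ∩ {x | f x ≤ 0}) * volume (ball x₀ r ∩ {x | H ≤ f x})) ≤
      ENNReal.ofReal (2 * r) * volume (ball (0 : E) (2 * r)) *
        ∫⁻ x in ball x₀ (3 * r), ‖fderiv ℝ f x‖ₑ := by
  set P := ball x₀ r ∩ {x | f x ≤ 0} with hP
  set Q := ball x₀ r ∩ {x | H ≤ f x} with hQ
  have hfc := hf.continuous
  have hPm : MeasurableSet P := measurableSet_ball.inter (measurableSet_le hfc.measurable measurable_const)
  have hQm : MeasurableSet Q := measurableSet_ball.inter (measurableSet_le measurable_const hfc.measurable)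
  have h1 : ENNReal.ofReal H * (volume P * volume Q) =
      ∫⁻ _ in P, ∫⁻ _ in Q, ENNReal.ofReal H := by
    simp only [lintegral_const, Measure.restrict_apply_univ]
    ring
  -- Two points of the ball differ by less than `2r`, and `f` grows by at least `H` from a point of
  -- `P` to a point `x + h` of `Q`.
  have h2 : ∀ x ∈ P, ∫⁻ _ in Q, ENNReal.ofReal H ≤
      ∫⁻ h in ball (0 : E) (2 * r), ‖f (x + h) - f x‖ₑ := by
    intro x hx
    rw [← lintegral_indicator hQm, ← lintegral_indicator measurableSet_ball,
      ← lintegral_add_left_eq_self (Q.indicator fun _ => ENNReal.ofReal H) x]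
    refine lintegral_mono fun h => ?_
    by_cases hh : x + h ∈ Q
    · have hb : h ∈ ball (0 : E) (2 * r) := by
        have a1 := hx.1
        have a2 := hh.1
        rw [mem_ball, dist_eq_norm] at a1 a2
        rw [mem_ball_zero_iff]
        calc ‖h‖ = ‖(x + h - x₀) - (x - x₀)‖ := by congr 1; abel
          _ ≤ ‖x + h - x₀‖ + ‖x - x₀‖ := _root_.norm_sub_le _ _
          _ < 2 * r := by linarith
      have h3 : H ≤ ‖f (x + h) - f x‖ := by
        have a1 : f x ≤ 0 := hx.2
        have a2 : H ≤ f (x + h) := hh.2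
        rw [Real.norm_eq_abs]
        exact le_trans (by linarith) (le_abs_self _)
      simp only [hh, hb, indicator_of_mem]
      rw [← ofReal_norm]
      exact ENNReal.ofReal_le_ofReal h3
    · simp [hh]
  rw [h1]
  refine (setLIntegral_mono' hPm h2).trans ?_
  refine (lintegral_mono_set (inter_subset_left : P ⊆ ball x₀ r)).trans ?_
  have hm : Continuous fun p : E × E => f (p.1 + p.2) - f p.1 := by fun_prop
  rw [lintegral_lintegral_swap hm.measurable.enorm.aemeasurable]
  have h3 : ∀ h ∈ ball (0 : E) (2 * r), ∫⁻ x in ball x₀ r, ‖f (x + h) - f x‖ₑ ≤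
      ENNReal.ofReal (2 * r) * ∫⁻ x in ball x₀ (3 * r), ‖fderiv ℝ f x‖ₑ := by
    intro h hh
    rw [mem_ball_zero_iff] at hh
    refine (hf.lintegral_ball_enorm_add_sub_le x₀ h r).trans ?_
    refine mul_le_mul' ?_ (lintegral_mono_set (ball_subset_ball (by linarith)))
    rw [← ofReal_norm]
    exact ENNReal.ofReal_le_ofReal hh.le
  refine (setLIntegral_mono' measurableSet_ball h3).trans (le_of_eq ?_)
  simp only [lintegral_const, Measure.restrict_apply_univ]
  ring

end Mollification

/-! ### Partial derivatives, truncations and products -/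

section Pointwise

variable {n : ℕ}

local notation "E" => EuclideanSpace ℝ (Fin n)

theorem measurable_partialD (i : Fin n) (f : E → ℝ) : Measurable (partialD i f) :=
  (measurable_fderiv ℝ f).apply_continuousLinearMap _

theorem abs_partialD_le (i : Fin n) (f : E → ℝ) (x : E) : |partialD i f x| ≤ ‖fderiv ℝ f x‖ := by
  simpa [partialD] using (fderiv ℝ f x).le_opNorm (EuclideanSpace.single i 1)

theorem sum_mul_partialD (f : E → ℝ) (x y : E) : ∑ i, y i * partialD i f x = fderiv ℝ f x y := by
  conv_rhs => rw [← (EuclideanSpace.basisFun (Fin n) ℝ).sum_repr y]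
  simp [partialD, map_sum]

theorem norm_fderiv_le_norm_partialD (f : E → ℝ) (x : E) :
    ‖fderiv ℝ f x‖ ≤ ‖(WithLp.toLp 2 fun i => partialD i f x : E)‖ := by
  refine ContinuousLinearMap.opNorm_le_bound _ (norm_nonneg _) fun y => ?_
  have : fderiv ℝ f x y = inner ℝ y (WithLp.toLp 2 fun i => partialD i f x : E) := by
    rw [← sum_mul_partialD, PiLp.inner_apply]
    simp [mul_comm]
  rw [this, mul_comm]
  exact norm_inner_le_norm _ _

theorem partialD_eq_zero_of_notMem_tsupport (i : Fin n) {f : E → ℝ} {x : E} (hx : x ∉ tsupport f) :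
    partialD i f x = 0 := by
  simp [partialD, fderiv_of_notMem_tsupport ℝ hx]

/-- The truncation `(k - u)₊` has gradient `- Du` on `{u < k}` and `0` elsewhere. -/
theorem fderiv_max_sub_of_lt {u : E → ℝ} (hu : Continuous u) {k : ℝ} {x : E} (hx : u x < k) :
    fderiv ℝ (fun y => max (k - u y) 0) x = -fderiv ℝ u x := by
  have : (fun y => max (k - u y) 0) =ᶠ[𝓝 x] fun y => k - u y := by
    filter_upwards [(isOpen_lt hu continuous_const).mem_nhds hx] with y hy
    exact max_eq_left (sub_nonneg.2 (le_of_lt hy))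
  rw [this.fderiv_eq, fderiv_const_sub]

/-- The truncation has a global minimum at `x`. This covers the level set `u = k` too: if
differentiability fails there, `fderiv` is `0` by convention. -/
theorem fderiv_max_sub_of_le {u : E → ℝ} {k : ℝ} {x : E} (hx : k ≤ u x) :
    fderiv ℝ (fun y => max (k - u y) 0) x = 0 := by
  refine IsLocalMin.fderiv_eq_zero (Eventually.of_forall fun y => ?_)
  simp [hx]

theorem LipschitzWith.exists_mul {X : Type*} [PseudoMetricSpace X] {f g : X → ℝ} {C D : ℝ≥0}
    {A B : ℝ} (hf : LipschitzWith C f) (hg : LipschitzWith D g) (hA : ∀ x, |f x| ≤ A)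
    (hB : ∀ x, |g x| ≤ B) : ∃ C' : ℝ≥0, LipschitzWith C' fun x => f x * g x := by
  refine ⟨Real.toNNReal A * D + Real.toNNReal B * C, LipschitzWith.of_dist_le_mul fun x y => ?_⟩
  have h1 := hf.dist_le_mul x y
  have h2 := hg.dist_le_mul x y
  rw [Real.dist_eq] at *
  have e : f x * g x - f y * g y = f x * (g x - g y) + g y * (f x - f y) := by ring
  rw [e]
  refine (abs_add_le _ _).trans ?_
  rw [abs_mul, abs_mul]
  have hA0 : 0 ≤ A := (abs_nonneg _).trans (hA x)
  have hB0 : 0 ≤ B := (abs_nonneg _).trans (hB x)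
  push_cast
  rw [Real.coe_toNNReal _ hA0, Real.coe_toNNReal _ hB0, add_mul, mul_assoc, mul_assoc]
  exact add_le_add (mul_le_mul (hA x) h2 (abs_nonneg _) hA0)
    (mul_le_mul (hB y) h1 (abs_nonneg _) hB0)

end Pointwise

/-! ### The Caccioppoli inequality -/

section Energy

variable {n : ℕ}

local notation "E" => EuclideanSpace ℝ (Fin n)

/-- `div b ≤ 0` may be tested with nonnegative Lipschitz functions. -/
theorem DivNonposDistrib.integral_nonneg {b : E → E} {Ω : Set E} (hΩ : IsOpen Ω)
    (hb : ∀ K, IsCompact K → K ⊆ Ω → IntegrableOn b K) (hdiv : DivNonposDistrib b Ω)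
    {ζ : E → ℝ} {C : ℝ≥0} (hζ : LipschitzWith C ζ) (hc : HasCompactSupport ζ)
    (hs : tsupport ζ ⊆ Ω) (h0 : ∀ x, 0 ≤ ζ x) :
    0 ≤ ∫ x in Ω, fderiv ℝ ζ x (b x) := by
  -- As `b` is only locally integrable, the mollified test functions must eventually be supported in
  -- one compact `K ⊆ Ω`.
  obtain ⟨δ, hδ, hK⟩ := hc.isCompact.exists_cthickening_subset_open hΩ hs
  set K := cthickening δ (tsupport ζ)
  have hKc : IsCompact K := hc.isCompact.cthickening
  obtain ⟨g, hg, -, hgb, hga, hg0, hgs, -⟩ := hζ.exists_contDiff_approx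
  have hsub : ∀ f : E → ℝ, tsupport f ⊆ K →
      ∫ x in Ω, fderiv ℝ f x (b x) = ∫ x in K, fderiv ℝ f x (b x) := fun f hf =>
    setIntegral_eq_of_subset_of_forall_sdiff_eq_zero hΩ.measurableSet hK fun x hx => by
      rw [fderiv_of_notMem_tsupport ℝ fun h => hx.2 (hf h)]; rfl
  rw [hsub ζ (self_subset_cthickening _)]
  have hlim : Tendsto (fun k => ∫ x in K, fderiv ℝ (g k) x (b x)) atTop
      (𝓝 (∫ x in K, fderiv ℝ ζ x (b x))) := by
    refine tendsto_integral_of_dominated_convergence (fun x => C * ‖b x‖) (fun k => ?_)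
      ((hb K hKc hK).norm.const_mul _) (fun k => Eventually.of_forall fun x => ?_) ?_
    · exact isBoundedBilinearMap_apply.continuous.comp_aestronglyMeasurable
        ((measurable_fderiv ℝ (g k)).aestronglyMeasurable.prodMk (hb K hKc hK).aestronglyMeasurable)
    · exact (ContinuousLinearMap.le_opNorm _ _).trans
        (mul_le_mul_of_nonneg_right (hgb k x) (norm_nonneg _))
    · filter_upwards [ae_restrict_of_ae hga] with x hx
      exact ((ContinuousLinearMap.apply ℝ ℝ (b x)).continuous.tendsto _).comp hx
  refine ge_of_tendsto hlim ?_
  have hev : ∀ᶠ k : ℕ in atTop, 1 / ((k : ℝ) + 1) ≤ δ :=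
    (tendsto_one_div_add_atTop_nhds_zero_nat.eventually (gt_mem_nhds hδ)).mono fun _ h => h.le
  filter_upwards [hev] with k hk
  have hsK : tsupport (g k) ⊆ K := (hgs k).trans (cthickening_mono hk _)
  have h1 := hdiv (g k) (hg k) (hKc.of_isClosed_subset (isClosed_tsupport _) hsK) (hsK.trans hK)
    (hg0 h0 k)
  simp only [sum_mul_partialD] at h1
  rw [← hsub _ hsK]
  linarith

/-- For the mixed term `a Dv · Dφ`. The matrix need not be symmetric, and ellipticity sees only its
symmetric part, so the bound uses the entries. -/
theorem abs_sum_sum_mul_le {A : Matrix (Fin n) (Fin n) ℝ} {P Q : Fin n → ℝ} {M p L : ℝ}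
    (hA : ∀ i j, |A i j| ≤ M) (hP : ∀ i, |P i| ≤ p) (hQ : ∀ i, |Q i| ≤ L) :
    |∑ i, ∑ j, A i j * P j * Q i| ≤ n ^ 2 * M * p * L := by
  have h1 : ∀ i j, |A i j * P j * Q i| ≤ M * p * L := fun i j => by
    rw [abs_mul, abs_mul]
    have := (abs_nonneg _).trans (hA i j)
    have := (abs_nonneg _).trans (hP j)
    gcongr
    exacts [hA i j, hP j, hQ i]
  calc |∑ i, ∑ j, A i j * P j * Q i| ≤ ∑ i, ∑ j, |A i j * P j * Q i| :=
        (Finset.abs_sum_le_sum_abs _ _).trans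
          (Finset.sum_le_sum fun i _ => Finset.abs_sum_le_sum_abs _ _)
    _ ≤ ∑ i : Fin n, ∑ j : Fin n, M * p * L :=
        Finset.sum_le_sum fun i _ => Finset.sum_le_sum fun j _ => h1 i j
    _ = _ := by simp; ring

/-- Here `p = |Dv|`, `S = a Dv · Dv`, `T = a Dv · Dφ`, `D = b · Dv`, `B = b · Dφ` and `β = |b|`. The
inner bracket adds the supersolution integrand to half the divergence integrand, which cancels `D`.
Young's inequality then absorbs the mixed term into half of `ν φ² p²`. -/
theorem caccioppoli_pointwise {ν p φ v L k N S T B D β : ℝ} (hν : 0 < ν)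
    (hφ0 : 0 ≤ φ) (hφ1 : φ ≤ 1) (hv0 : 0 ≤ v) (hvk : v ≤ k) (hL : 0 ≤ L) (hβ : 0 ≤ β)
    (hS : ν * p ^ 2 ≤ S) (hT : -(N * p * L) ≤ T) (hB : B ≤ L * β) :
    φ ^ 2 * p ^ 2 ≤ 2 / ν * ((2 * N ^ 2 / ν + 1) * k ^ 2 * (L ^ 2 + L * β) -
      (-(φ ^ 2 * S + 2 * v * φ * T) + -(D * (v * φ ^ 2)) +
        1 / 2 * (2 * (v * φ ^ 2 * D + v ^ 2 * φ * B)))) := by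
  have hv2 : v ^ 2 ≤ k ^ 2 := pow_le_pow_left₀ hv0 hvk 2
  have e1 : φ ^ 2 * (ν * p ^ 2) ≤ φ ^ 2 * S := mul_le_mul_of_nonneg_left hS (sq_nonneg φ)
  have e2 : 2 * v * φ * -(N * p * L) ≤ 2 * v * φ * T :=
    mul_le_mul_of_nonneg_left hT (by positivity)
  have e3 : 2 * N * (v * L) * (φ * p) ≤
      ν / 2 * (φ * p) ^ 2 + 2 * N ^ 2 / ν * (v * L) ^ 2 := by
    have h : ν / 2 * (φ * p) ^ 2 + 2 * N ^ 2 / ν * (v * L) ^ 2 -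
      2 * N * (v * L) * (φ * p) = ν / 2 * (φ * p - 2 * N / ν * (v * L)) ^ 2 := by
      field_simp; ring
    have : 0 ≤ ν / 2 * (φ * p - 2 * N / ν * (v * L)) ^ 2 := by positivity
    linarith
  have e4 : v ^ 2 * φ * B ≤ k ^ 2 * (L * β) :=
    (mul_le_mul_of_nonneg_left hB (by positivity)).trans
      (mul_le_mul_of_nonneg_right ((mul_le_of_le_one_right (sq_nonneg _) hφ1).trans hv2)
        (by positivity))
  have e5 : 2 * N ^ 2 / ν * (v * L) ^ 2 ≤ 2 * N ^ 2 / ν * (k ^ 2 * L ^ 2) := by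
    rw [mul_pow]
    exact mul_le_mul_of_nonneg_left (mul_le_mul_of_nonneg_right hv2 (sq_nonneg _)) (by positivity)
  have a1 : 0 ≤ 2 * N ^ 2 / ν * (k ^ 2 * (L * β)) := by positivity
  have a2 : 0 ≤ k ^ 2 * L ^ 2 := by positivity
  have e7 : φ ^ 2 * p ^ 2 = 2 / ν * (ν / 2 * (φ * p) ^ 2) := by field_simp
  rw [e7]
  refine mul_le_mul_of_nonneg_left ?_ (by positivity)
  linarith

/-- The Caccioppoli inequality for the truncations of a nonnegative Lipschitz supersolution. -/
theorem IsLipschitzSupersolution.exists_energy_bound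
    {a : E → Matrix (Fin n) (Fin n) ℝ} {b : E → E} {Ω : Set E} (hΩ : IsOpen Ω) {ν : ℝ} (hν : 0 < ν)
    (ha_loc : ∀ i j, MemLpLoc (fun x => a x i j) ⊤ Ω) (ha : UniformlyElliptic ν a Ω)
    (hb : ∀ K, IsCompact K → K ⊆ Ω → IntegrableOn b K) (hdiv : DivNonposDistrib b Ω)
    {u : E → ℝ} {Cu : ℝ≥0} (huL : LipschitzWith Cu u) (hu : IsLipschitzSupersolution a b Ω u)
    (hu0 : ∀ x, 0 ≤ u x) {K₀ : Set E} (hK₀ : IsCompact K₀)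
    (hK₀Ω : K₀ ⊆ Ω) :
    ∃ Λ : ℝ, 0 ≤ Λ ∧ ∀ k : ℝ, 0 ≤ k → ∀ K, IsCompact K → K ⊆ K₀ →
      ∀ (φ : E → ℝ) (L : ℝ≥0), LipschitzWith L φ → (∀ x, 0 ≤ φ x) → (∀ x, φ x ≤ 1) →
      tsupport φ ⊆ K →
      ∫ x in K, φ x ^ 2 * ‖fderiv ℝ (fun y => max (k - u y) 0) x‖ ^ 2 ≤
        Λ * k ^ 2 * (L ^ 2 * volume.real (K ∩ {x | u x < k}) +
          L * ∫ x in K ∩ {x | u x < k}, ‖b x‖) := by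
  have hMex : ∀ i j, ∃ M : ℝ, ∀ᵐ x ∂(volume.restrict K₀), |a x i j| ≤ M := fun i j => by
    have h := (ha_loc i j K₀ hK₀ hK₀Ω).2
    rw [eLpNorm_exponent_top] at h
    refine ⟨(eLpNormEssSup (fun x => a x i j) (volume.restrict K₀)).toReal, ?_⟩
    filter_upwards [ae_le_eLpNormEssSup (f := fun x => a x i j) (μ := volume.restrict K₀)] with x hx
    have := ENNReal.toReal_mono h.ne hx
    simpa using this
  choose M' hM' using hMex
  -- One bound for all entries on `K₀`, so that the final constant does not depend on `k`, `K` or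
  -- `φ`.
  set M : ℝ := ∑ i, ∑ j, |M' i j|
  have hMK : ∀ᵐ x ∂(volume.restrict K₀), ∀ i j, |a x i j| ≤ M := by
    rw [ae_all_iff]; intro i; rw [ae_all_iff]; intro j
    filter_upwards [hM' i j] with x hx
    refine hx.trans ((le_abs_self _).trans ?_)
    refine le_trans ?_ (Finset.single_le_sum (f := fun i => ∑ j, |M' i j|)
      (fun i _ => Finset.sum_nonneg fun j _ => abs_nonneg _) (Finset.mem_univ i))
    exact Finset.single_le_sum (f := fun j => |M' i j|) (fun j _ => abs_nonneg _) (Finset.mem_univ j)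
  set c₀ : ℝ := (2 * ((n : ℝ) ^ 2 * M) ^ 2 / ν + 1)
  have hc0' : 1 ≤ c₀ := by
    have : 0 ≤ 2 * ((n : ℝ) ^ 2 * M) ^ 2 / ν := by positivity
    linarith
  refine ⟨2 / ν * c₀, by positivity, fun k hk K hK hKK₀ φ L hφ hφ0 hφ1 hφK => ?_⟩
  have hKΩ : K ⊆ Ω := hKK₀.trans hK₀Ω
  have hM := ae_restrict_of_ae_restrict_of_subset hKK₀ hMK
  have haK : ∀ᵐ x ∂(volume.restrict K), ∀ ξ : E, ν * ‖ξ‖ ^ 2 ≤ ∑ i, ∑ j, a x i j * ξ i * ξ j :=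
    (ae_restrict_of_ae_restrict_of_subset hKΩ ha).mono fun x hx ξ => (hx ξ).1
  have : IsFiniteMeasure (volume.restrict K) := ⟨by simpa using hK.measure_lt_top⟩
  have haI : ∀ i j, IntegrableOn (fun x => a x i j) K := fun i j =>
    memLp_one_iff_integrable.1 ((ha_loc i j K hK hKΩ).mono_exponent le_top)
  have hbI : IntegrableOn b K := hb K hK hKΩ
  set v : E → ℝ := fun y => max (k - u y) 0 with hv
  have hv0 : ∀ x, 0 ≤ v x := fun x => le_max_right _ _
  have hvk : ∀ x, v x ≤ k := fun x => max_le (by linarith [hu0 x]) hk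
  have hvL : LipschitzWith Cu v := by
    have : LipschitzWith (0 + Cu) fun y => k - u y := (LipschitzWith.const k).sub huL
    simpa using this.max_const 0
  have hvabs : ∀ x, |v x| ≤ k := fun x => by rw [abs_of_nonneg (hv0 x)]; exact hvk x
  have hφabs : ∀ x, |φ x| ≤ 1 := fun x => by rw [abs_of_nonneg (hφ0 x)]; exact hφ1 x
  obtain ⟨C1, hC1⟩ := hvL.exists_mul hφ hvabs hφabs
  have hvφabs : ∀ x, |v x * φ x| ≤ k * 1 := fun x => by
    rw [abs_mul]; exact mul_le_mul (hvabs x) (hφabs x) (abs_nonneg _) hk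
  -- `η = v φ²` tests the supersolution, `ζ = (v φ)²` tests `div b ≤ 0`.
  set η : E → ℝ := fun x => v x * φ x * φ x with hη
  set ζ : E → ℝ := fun x => v x * φ x * (v x * φ x) with hζ
  obtain ⟨C2, hC2⟩ := hC1.exists_mul hφ hvφabs hφabs
  obtain ⟨C3, hC3⟩ := hC1.exists_mul hC1 hvφabs hvφabs
  have hηs : tsupport η ⊆ tsupport φ := closure_mono fun x hx h => hx (by simp [hη, h])
  have hζs : tsupport ζ ⊆ tsupport φ := closure_mono fun x hx h => hx (by simp [hζ, h])
  have hη0 : ∀ x, 0 ≤ η x := fun x => mul_nonneg (mul_nonneg (hv0 x) (hφ0 x)) (hφ0 x)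
  have hζ0 : ∀ x, 0 ≤ ζ x := fun x => mul_self_nonneg _
  have hηc : HasCompactSupport η := hK.of_isClosed_subset (isClosed_tsupport _) (hηs.trans hφK)
  have hζc : HasCompactSupport ζ := hK.of_isClosed_subset (isClosed_tsupport _) (hζs.trans hφK)
  set F1 : E → ℝ := fun x => (∑ i, ∑ j, a x i j * partialD j u x * partialD i η x) +
        ∑ i, b x i * partialD i u x * η x with hF1
  set F2 : E → ℝ := fun x => fderiv ℝ ζ x (b x) with hF2
  have h1 : 0 ≤ ∫ x in K, F1 x := by
    have := hu.2 η ⟨C2, hC2⟩ hηc (hηs.trans (hφK.trans hKΩ)) hη0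
    rwa [setIntegral_eq_of_subset_of_forall_sdiff_eq_zero hΩ.measurableSet hKΩ] at this
    intro x hx
    have hx' : x ∉ tsupport η := fun h => hx.2 (hφK (hηs h))
    simp [partialD_eq_zero_of_notMem_tsupport _ hx', image_eq_zero_of_notMem_tsupport hx']
  have h2 : 0 ≤ ∫ x in K, F2 x := by
    have := hdiv.integral_nonneg hΩ hb hC3 hζc (hζs.trans (hφK.trans hKΩ)) hζ0
    rwa [setIntegral_eq_of_subset_of_forall_sdiff_eq_zero hΩ.measurableSet hKΩ] at this
    intro x hx
    have hx' : x ∉ tsupport ζ := fun h => hx.2 (hφK (hζs h))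
    rw [fderiv_of_notMem_tsupport ℝ hx']
    rfl
  have hpd : ∀ {f : E → ℝ} {C : ℝ≥0}, LipschitzWith C f → ∀ i x, |partialD i f x| ≤ C :=
    fun hf i x => (abs_partialD_le i _ x).trans (norm_fderiv_le_of_lipschitz ℝ hf)
  have hI1 : IntegrableOn F1 K := by
    refine Integrable.add (integrable_finsetSum _ fun i _ => integrable_finsetSum _ fun j _ => ?_)
      (integrable_finsetSum _ fun i _ => ?_)
    · refine ((haI i j).mul_bdd (c := Cu) (measurable_partialD j u).aestronglyMeasurable
        (Eventually.of_forall fun x => hpd huL j x)).mul_bdd (c := C2)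
        (measurable_partialD i η).aestronglyMeasurable (Eventually.of_forall fun x => hpd hC2 i x)
    · have hbi : IntegrableOn (fun x => b x i) K :=
        (EuclideanSpace.proj (𝕜 := ℝ) i).integrable_comp hbI
      refine (hbi.mul_bdd (c := Cu) (measurable_partialD i u).aestronglyMeasurable
        (Eventually.of_forall fun x => hpd huL i x)).mul_bdd (c := k * 1 * 1)
        hC2.continuous.aestronglyMeasurable (Eventually.of_forall fun x => ?_)
      rw [Real.norm_eq_abs, hη, abs_mul]
      exact mul_le_mul (hvφabs x) (hφabs x) (abs_nonneg _) (by simpa using hk)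
  have hI2 : IntegrableOn F2 K := by
    refine (hbI.norm.const_mul C3).mono'
      (isBoundedBilinearMap_apply.continuous.comp_aestronglyMeasurable
        ((measurable_fderiv ℝ ζ).aestronglyMeasurable.prodMk hbI.aestronglyMeasurable))
      (Eventually.of_forall fun x => ?_)
    exact (ContinuousLinearMap.le_opNorm _ _).trans
        (mul_le_mul_of_nonneg_right (norm_fderiv_le_of_lipschitz ℝ hC3) (norm_nonneg _))
  have hAm : MeasurableSet {x | u x < k} :=
    measurableSet_lt huL.continuous.measurable measurable_const
  set G : E → ℝ := {x | u x < k}.indicator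
    fun x => c₀ * k ^ 2 * (L ^ 2 + L * ‖b x‖) with hG
  have hG0 : IntegrableOn (fun x => c₀ * k ^ 2 * (L ^ 2 + L * ‖b x‖)) K :=
    ((integrable_const _).add (hbI.norm.const_mul _)).const_mul _
  have hGI : IntegrableOn G K := hG0.indicator hAm
  -- After integration `F1` and `F2` can be dropped, since both have nonnegative integrals. Where `u
  -- ≥ k`, both sides are zero.
  have hpt : ∀ᵐ x ∂(volume.restrict K), φ x ^ 2 * ‖fderiv ℝ v x‖ ^ 2 ≤
      2 / ν * (G x - (F1 x + 1 / 2 * F2 x)) := by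
    filter_upwards [hM, haK, ae_restrict_of_ae hvL.ae_differentiableAt,
      ae_restrict_of_ae hφ.ae_differentiableAt] with x hMx hax hvx hφx
    have hdη : ∀ i, partialD i η x = φ x ^ 2 * partialD i v x + 2 * v x * φ x * partialD i φ x := by
      intro i
      have : HasFDerivAt η _ x := (hvx.hasFDerivAt.mul hφx.hasFDerivAt).mul hφx.hasFDerivAt
      simp only [partialD, this.fderiv]
      simp
      ring
    have hdζ : F2 x = 2 * (v x * φ x ^ 2 * fderiv ℝ v x (b x) +
        v x ^ 2 * φ x * fderiv ℝ φ x (b x)) := by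
      have : HasFDerivAt ζ _ x :=
        (hvx.hasFDerivAt.mul hφx.hasFDerivAt).mul (hvx.hasFDerivAt.mul hφx.hasFDerivAt)
      simp only [hF2, this.fderiv]
      simp
      ring
    by_cases hxk : u x < k
    · have hdu : ∀ i, partialD i u x = - partialD i v x := fun i => by
        simp [partialD, hv, fderiv_max_sub_of_lt huL.continuous hxk]
      have hbv : ∑ i, b x i * partialD i u x * η x = - (fderiv ℝ v x (b x) * η x) := by
        rw [← sum_mul_partialD, Finset.sum_mul, ← Finset.sum_neg_distrib]
        exact Finset.sum_congr rfl fun i _ => by rw [hdu]; ring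
      have hav : ∑ i, ∑ j, a x i j * partialD j u x * partialD i η x =
          - (φ x ^ 2 * (∑ i, ∑ j, a x i j * partialD i v x * partialD j v x) +
            2 * v x * φ x * ∑ i, ∑ j, a x i j * partialD j v x * partialD i φ x) := by
        simp only [Finset.mul_sum, ← Finset.sum_add_distrib, ← Finset.sum_neg_distrib]
        exact Finset.sum_congr rfl fun i _ => Finset.sum_congr rfl fun j _ => by
          rw [hdu, hdη]; ring
      set p := ‖fderiv ℝ v x‖
      have hell : ν * p ^ 2 ≤ ∑ i, ∑ j, a x i j * partialD i v x * partialD j v x := by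
        refine le_trans ?_ (hax (WithLp.toLp 2 fun i => partialD i v x))
        gcongr
        exact norm_fderiv_le_norm_partialD v x
      have hmix := abs_le.1 (abs_sum_sum_mul_le hMx (fun j => abs_partialD_le j v x)
        (fun i => hpd hφ i x))
      have hbφ : |fderiv ℝ φ x (b x)| ≤ L * ‖b x‖ :=
        (ContinuousLinearMap.le_opNorm _ _).trans
          (mul_le_mul_of_nonneg_right (norm_fderiv_le_of_lipschitz ℝ hφ) (norm_nonneg _))
      have hGx : G x = c₀ * k ^ 2 * (L ^ 2 + L * ‖b x‖) := by
        simp only [hG]; rw [indicator_of_mem (show x ∈ {x | u x < k} from hxk)]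
      rw [hGx, hdζ]
      simp only [hF1]
      rw [hbv, hav]
      have e8 : η x = v x * φ x ^ 2 := by simp only [hη]; ring
      rw [e8]
      exact caccioppoli_pointwise hν (hφ0 x) (hφ1 x) (hv0 x) (hvk x) L.2 (norm_nonneg _)
        hell hmix.1 ((le_abs_self _).trans hbφ)
    · have hxk' : k ≤ u x := not_lt.1 hxk
      have hvx0 : v x = 0 := by simp [hv, hxk']
      have hdv : fderiv ℝ v x = 0 := fderiv_max_sub_of_le hxk'
      have hη' : ∀ i, partialD i η x = 0 := fun i => by
        rw [hdη, hvx0]; simp [partialD, hdv]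
      have hη'' : η x = 0 := by simp [hη, hvx0]
      have hG' : G x = 0 := by
        simp only [hG]; rw [indicator_of_notMem (show x ∉ {x | u x < k} from hxk)]
      simp only [hF1]
      rw [hdζ, hG', hη'', hvx0, hdv]
      simp [hη']
  have hright : IntegrableOn (fun x => 2 / ν * (G x - (F1 x + 1 / 2 * F2 x))) K :=
    (hGI.sub (hI1.add (hI2.const_mul _))).const_mul _
  have hGint : ∫ x in K, G x = c₀ * k ^ 2 * (L ^ 2 * volume.real (K ∩ {x | u x < k}) +
          L * ∫ x in K ∩ {x | u x < k}, ‖b x‖) := by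
    rw [hG, setIntegral_indicator hAm, integral_const_mul, integral_add, integral_const_mul]
    · simp [mul_comm]
    · exact integrableOn_const (hs := ((measure_mono inter_subset_left).trans_lt
        hK.measure_lt_top).ne)
    · exact (hbI.mono_set inter_subset_left).norm.const_mul _
  have hI12 : IntegrableOn (fun x => F1 x + 1 / 2 * F2 x) K := hI1.add (hI2.const_mul _)
  calc ∫ x in K, φ x ^ 2 * ‖fderiv ℝ v x‖ ^ 2
      ≤ ∫ x in K, 2 / ν * (G x - (F1 x + 1 / 2 * F2 x)) :=
        integral_mono_of_nonneg (Eventually.of_forall fun x => by positivity) hright hpt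
    _ = 2 / ν * ((∫ x in K, G x) - ((∫ x in K, F1 x) + 1 / 2 * ∫ x in K, F2 x)) := by
        rw [integral_const_mul, integral_sub hGI hI12,
          integral_add hI1 (hI2.const_mul _), integral_const_mul]
    _ ≤ 2 / ν * ∫ x in K, G x := by
        refine mul_le_mul_of_nonneg_left ?_ (by positivity)
        linarith
    _ = _ := by rw [hGint]; ring

end Energy

/-! ### De Giorgi classes and decay of sublevel sets -/

section DeGiorgi

variable {n : ℕ}

local notation "E" => EuclideanSpace ℝ (Fin n)

/-- `u` belongs to a De Giorgi class on `K₀`: its truncations `(k - u)₊` satisfy a Caccioppoli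
inequality with an excess power `σ` of the measure of the sublevel set. -/
def HasTruncationEnergyBound (u : E → ℝ) (K₀ : Set E) (Λ σ : ℝ) : Prop :=
  ∀ k : ℝ, 0 ≤ k → ∀ K, IsCompact K → K ⊆ K₀ → ∀ (φ : E → ℝ) (L : ℝ≥0), LipschitzWith L φ →
    (∀ x, 0 ≤ φ x) → (∀ x, φ x ≤ 1) → tsupport φ ⊆ K → 1 ≤ L →
    ∫ x in K, φ x ^ 2 * ‖fderiv ℝ (fun y => max (k - u y) 0) x‖ ^ 2 ≤
      Λ * (k * L) ^ 2 * volume.real (K ∩ {x | u x < k}) ^ σ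

theorem setIntegral_norm_le_eLpNorm_mul_rpow {F : Type*} [NormedAddCommGroup F] {b : E → F}
    {q : ℝ} (hq : 1 ≤ q) {K S : Set E} (hS : S ⊆ K) (hK : volume K ≠ ⊤)
    (hb : MemLp b (ENNReal.ofReal q) (volume.restrict K)) :
    ∫ x in S, ‖b x‖ ≤ (eLpNorm b (ENNReal.ofReal q) (volume.restrict K)).toReal *
      volume.real S ^ (1 - 1 / q) := by
  have hSt : volume S ≠ ⊤ := ne_top_of_le_ne_top hK (measure_mono hS)
  have hle : volume.restrict S ≤ volume.restrict K := Measure.restrict_mono hS le_rfl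
  have hbS : MemLp b (ENNReal.ofReal q) (volume.restrict S) := hb.mono_measure hle
  have h1 := eLpNorm_le_eLpNorm_mul_rpow_measure_univ (p := 1)
    (ENNReal.one_le_ofReal.2 hq) hbS.aestronglyMeasurable
  rw [Measure.restrict_apply_univ, ENNReal.toReal_one, ENNReal.toReal_ofReal (by linarith),
    div_one] at h1
  have h0 : 0 ≤ 1 - 1 / q := by
    have : 1 / q ≤ 1 := by rw [div_le_one (by linarith)]; exact hq
    linarith
  have h2 : eLpNorm b 1 (volume.restrict S) ≤
      eLpNorm b (ENNReal.ofReal q) (volume.restrict K) * volume S ^ (1 - 1 / q) :=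
    h1.trans (mul_le_mul_left (eLpNorm_mono_measure b hle) _)
  rw [integral_norm_eq_lintegral_enorm hbS.aestronglyMeasurable, ← eLpNorm_one_eq_lintegral_enorm,
    measureReal_def, ENNReal.toReal_rpow, ← ENNReal.toReal_mul]
  exact ENNReal.toReal_mono (ENNReal.mul_ne_top hb.2.ne (ENNReal.rpow_ne_top_of_nonneg h0 hSt)) h2

theorem measureReal_le_rpow_mul_rpow {S K : Set E} (hS : S ⊆ K) (hK : volume K ≠ ⊤) {σ τ : ℝ}
    (hσ : 0 ≤ σ) (hστ : σ ≤ τ) :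
    volume.real S ^ τ ≤ volume.real K ^ (τ - σ) * volume.real S ^ σ := by
  have h0 : 0 ≤ volume.real S := measureReal_nonneg
  have h1 : volume.real S ≤ volume.real K := measureReal_mono hS hK
  calc volume.real S ^ τ = volume.real S ^ (τ - σ) * volume.real S ^ σ := by
        rw [← Real.rpow_add_of_nonneg h0 (by linarith) hσ, sub_add_cancel]
    _ ≤ _ := mul_le_mul_of_nonneg_right (Real.rpow_le_rpow h0 h1 (by linarith))
        (Real.rpow_nonneg h0 _)

/-- Hölder turns the drift term into the power `1 - 1/q` of the measure; the term linear in the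
measure is lowered to the same power at the cost of a power of `volume.real K₀`. The condition `1 ≤
L` lets `L ^ 2` majorize `L`. -/
theorem IsLipschitzSupersolution.exists_hasTruncationEnergyBound
    {a : E → Matrix (Fin n) (Fin n) ℝ} {b : E → E} {Ω : Set E} (hΩ : IsOpen Ω) {ν : ℝ} (hν : 0 < ν)
    (ha_loc : ∀ i j, MemLpLoc (fun x => a x i j) ⊤ Ω) (ha : UniformlyElliptic ν a Ω)
    {q : ℝ} (hq : 1 ≤ q) (hb : MemLpLoc b (ENNReal.ofReal q) Ω) (hdiv : DivNonposDistrib b Ω)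
    {u : E → ℝ} {Cu : ℝ≥0} (huL : LipschitzWith Cu u) (hu : IsLipschitzSupersolution a b Ω u)
    (hu0 : ∀ x, 0 ≤ u x) {K₀ : Set E} (hK₀ : IsCompact K₀) (hK₀Ω : K₀ ⊆ Ω) :
    ∃ Λ : ℝ, 0 ≤ Λ ∧ HasTruncationEnergyBound u K₀ Λ (1 - 1 / q) := by
  have hbi : ∀ K, IsCompact K → K ⊆ Ω → IntegrableOn b K := fun K hK hKΩ => by
    have : IsFiniteMeasure (volume.restrict K) := ⟨by simpa using hK.measure_lt_top⟩
    exact memLp_one_iff_integrable.1 ((hb K hK hKΩ).mono_exponent (ENNReal.one_le_ofReal.2 hq))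
  obtain ⟨Λ, hΛ, h⟩ := hu.exists_energy_bound hΩ hν ha_loc ha hbi hdiv huL hu0 hK₀ hK₀Ω
  have h1q : 1 / q ≤ 1 := by rw [div_le_one (by linarith)]; exact hq
  set β := (eLpNorm b (ENNReal.ofReal q) (volume.restrict K₀)).toReal
  have hβ : 0 ≤ β := ENNReal.toReal_nonneg
  set γ := volume.real K₀ ^ (1 - (1 - 1 / q))
  have hγ : 0 ≤ γ := Real.rpow_nonneg measureReal_nonneg _
  refine ⟨Λ * (γ + β), by positivity, fun k hk K hK hKK₀ φ L hφ hφ0 hφ1 hφK hL => ?_⟩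
  refine (h k hk K hK hKK₀ φ L hφ hφ0 hφ1 hφK).trans ?_
  set A := K ∩ {x | u x < k}
  have hAK : A ⊆ K₀ := inter_subset_left.trans hKK₀
  have hL' : (1 : ℝ) ≤ L := by exact_mod_cast hL
  have e1 : volume.real A ≤ γ * volume.real A ^ (1 - 1 / q) := by
    have := measureReal_le_rpow_mul_rpow hAK hK₀.measure_lt_top.ne
      (by linarith : 0 ≤ 1 - 1 / q) (by have : 0 ≤ 1 / q := (by positivity); linarith : _ ≤ (1 : ℝ))
    rwa [Real.rpow_one] at this
  have e2 : ∫ x in A, ‖b x‖ ≤ β * volume.real A ^ (1 - 1 / q) :=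
    setIntegral_norm_le_eLpNorm_mul_rpow hq hAK hK₀.measure_lt_top.ne (hb K₀ hK₀ hK₀Ω)
  set t := volume.real A ^ (1 - 1 / q)
  have ht : 0 ≤ t := Real.rpow_nonneg measureReal_nonneg _
  have e3 : (L : ℝ) ^ 2 * volume.real A + L * ∫ x in A, ‖b x‖ ≤ L ^ 2 * ((γ + β) * t) := by
    have a1 : (L : ℝ) ^ 2 * volume.real A ≤ L ^ 2 * (γ * t) :=
      mul_le_mul_of_nonneg_left e1 (sq_nonneg _)
    have a2 : (L : ℝ) * ∫ x in A, ‖b x‖ ≤ L ^ 2 * (β * t) :=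
      mul_le_mul (by nlinarith) e2 (integral_nonneg fun _ => norm_nonneg _) (sq_nonneg _)
    linarith
  calc _ ≤ Λ * k ^ 2 * (L ^ 2 * ((γ + β) * t)) := mul_le_mul_of_nonneg_left e3 (by positivity)
    _ = _ := by ring

/-- Cauchy–Schwarz: the quadratic `t ↦ ∫ (t - g)²` is nonnegative, so its discriminant is not
positive. -/
theorem sq_setIntegral_le {g : E → ℝ} {S : Set E} (hS : volume S ≠ ⊤)
    (hg : IntegrableOn g S) (hg2 : IntegrableOn (fun x => g x ^ 2) S) :
    (∫ x in S, g x) ^ 2 ≤ volume.real S * ∫ x in S, g x ^ 2 := by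
  have key : ∀ t : ℝ, 0 ≤ volume.real S * (t * t) + (-2 * ∫ x in S, g x) * t +
      ∫ x in S, g x ^ 2 := by
    intro t
    have hc : IntegrableOn (fun _ : E => t * t) S := integrableOn_const hS
    have hgt : IntegrableOn (fun x => (-2 * t) * g x) S := hg.const_mul _
    have hs : IntegrableOn (fun x => t * t + (-2 * t) * g x) S := hc.add hgt
    have : ∫ x in S, (t * t + (-2 * t) * g x + g x ^ 2) =
        volume.real S * (t * t) + (-2 * ∫ x in S, g x) * t + ∫ x in S, g x ^ 2 := by
      have e := integral_const_mul (μ := volume.restrict S) (-2 * t) g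
      rw [integral_add hs hg2, integral_add hc hgt, e, setIntegral_const, smul_eq_mul]
      ring
    rw [← this]
    refine integral_nonneg fun x => ?_
    change 0 ≤ t * t + (-2 * t) * g x + g x ^ 2
    nlinarith [sq_nonneg (t - g x)]
  have := discrim_le_zero key
  rw [discrim] at this
  linarith

theorem exists_lipschitz_cutoff (x₀ : E) {ρ ρ' : ℝ} (hρ : ρ < ρ') :
    ∃ φ : E → ℝ, LipschitzWith (Real.toNNReal (1 / (ρ' - ρ))) φ ∧ (∀ x, 0 ≤ φ x) ∧
      (∀ x, φ x ≤ 1) ∧ tsupport φ ⊆ closedBall x₀ ρ' ∧ ∀ x ∈ closedBall x₀ ρ, φ x = 1 := by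
  have hpos : 0 < ρ' - ρ := sub_pos.2 hρ
  refine ⟨fun x => max (min ((1 / (ρ' - ρ)) * (ρ' - dist x x₀)) 1) 0, ?_, fun x => le_max_right _ _,
    fun x => max_le (min_le_right _ _) zero_le_one, ?_, ?_⟩
  · refine LipschitzWith.max_const (LipschitzWith.min_const (LipschitzWith.of_dist_le_mul fun x y => ?_) _) _
    rw [Real.coe_toNNReal _ (by positivity), Real.dist_eq, ← mul_sub, abs_mul,
      abs_of_pos (by positivity : 0 < 1 / (ρ' - ρ))]
    refine mul_le_mul_of_nonneg_left ?_ (by positivity)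
    have := abs_dist_sub_le x y x₀
    rw [abs_sub_comm] at this
    rwa [show ρ' - dist x x₀ - (ρ' - dist y x₀) = dist y x₀ - dist x x₀ by ring]
  · refine closure_minimal (fun x hx => ?_) isClosed_closedBall
    by_contra h
    rw [mem_closedBall, not_le] at h
    apply hx
    have : (1 / (ρ' - ρ)) * (ρ' - dist x x₀) ≤ 0 :=
      mul_nonpos_of_nonneg_of_nonpos (by positivity) (by linarith)
    exact max_eq_right ((min_le_left _ _).trans this)
  · intro x hx
    rw [mem_closedBall] at hx
    have : 1 ≤ (1 / (ρ' - ρ)) * (ρ' - dist x x₀) := by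
      rw [one_div, inv_mul_eq_div, le_div_iff₀ hpos]
      linarith
    simp only
    rw [min_eq_right this, max_eq_left zero_le_one]

theorem lipschitzWith_max_sub {u : E → ℝ} {C : ℝ≥0} (hu : LipschitzWith C u) (k : ℝ) :
    LipschitzWith C fun y => max (k - u y) 0 := by
  have : LipschitzWith (0 + C) fun y => k - u y := (LipschitzWith.const k).sub hu
  simpa using this.max_const 0

theorem integrableOn_of_measurable_of_bound {g : E → ℝ} {S : Set E} (hg : Measurable g)
    (hS : volume S ≠ ⊤) {C : ℝ} (hC : ∀ x, |g x| ≤ C) : IntegrableOn g S :=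
  Measure.integrableOn_of_bounded hS hg.aestronglyMeasurable (Eventually.of_forall hC)

/-- The `L¹` form of the energy bound. -/
theorem HasTruncationEnergyBound.setIntegral_le {u : E → ℝ} {K₀ : Set E} {Λ σ : ℝ}
    (h : HasTruncationEnergyBound u K₀ Λ σ) (hΛ : 0 ≤ Λ) {C : ℝ≥0} (hu : LipschitzWith C u)
    {k : ℝ} (hk : 0 ≤ k) {K : Set E} (hK : IsCompact K) (hKK₀ : K ⊆ K₀) {φ : E → ℝ} {L : ℝ≥0}
    (hφ : LipschitzWith L φ) (hφ0 : ∀ x, 0 ≤ φ x) (hφ1 : ∀ x, φ x ≤ 1) (hφK : tsupport φ ⊆ K)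
    (hL : 1 ≤ L) {S : Set E} (hS : S ⊆ K) :
    ∫ x in S, φ x * ‖fderiv ℝ (fun y => max (k - u y) 0) x‖ ≤
      √Λ * (k * L) * (volume.real S * volume.real (K ∩ {x | u x < k}) ^ σ) ^ (1 / 2 : ℝ) := by
  set v : E → ℝ := fun y => max (k - u y) 0
  have hvL : LipschitzWith C v := lipschitzWith_max_sub hu k
  have hSt : volume S ≠ ⊤ := ne_top_of_le_ne_top hK.measure_lt_top.ne (measure_mono hS)
  have hm : Measurable fun x => φ x * ‖fderiv ℝ v x‖ :=
    hφ.continuous.measurable.mul (measurable_fderiv ℝ v).norm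
  have hb : ∀ x, |φ x * ‖fderiv ℝ v x‖| ≤ C := fun x => by
    rw [abs_of_nonneg (mul_nonneg (hφ0 x) (norm_nonneg _))]
    exact (mul_le_of_le_one_left (norm_nonneg _) (hφ1 x)).trans (norm_fderiv_le_of_lipschitz ℝ hvL)
  have hb2 : ∀ x, |(φ x * ‖fderiv ℝ v x‖) ^ 2| ≤ (C : ℝ) ^ 2 := fun x => by
    rw [abs_pow]; exact pow_le_pow_left₀ (abs_nonneg _) (hb x) 2
  have h1 := sq_setIntegral_le hSt (integrableOn_of_measurable_of_bound hm hSt hb)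
    (integrableOn_of_measurable_of_bound (hm.pow_const 2) hSt hb2)
  have h2 : ∫ x in S, (φ x * ‖fderiv ℝ v x‖) ^ 2 ≤
      Λ * (k * L) ^ 2 * volume.real (K ∩ {x | u x < k}) ^ σ := by
    refine le_trans ?_ (h k hk K hK hKK₀ φ L hφ hφ0 hφ1 hφK hL)
    simp_rw [← mul_pow]
    exact setIntegral_mono_set (integrableOn_of_measurable_of_bound (hm.pow_const 2)
      hK.measure_lt_top.ne hb2) (Eventually.of_forall fun x => sq_nonneg _) hS.eventuallyLE
  have ht : 0 ≤ volume.real (K ∩ {x | u x < k}) ^ σ := Real.rpow_nonneg measureReal_nonneg _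
  rw [← Real.sqrt_eq_rpow]
  refine abs_le_of_sq_le_sq' (a := ∫ x in S, φ x * ‖fderiv ℝ v x‖) ?_ (by positivity) |>.2
  rw [mul_pow, mul_pow, Real.sq_sqrt hΛ, Real.sq_sqrt (by positivity)]
  calc _ ≤ _ := h1
    _ ≤ volume.real S * (Λ * (k * L) ^ 2 * volume.real (K ∩ {x | u x < k}) ^ σ) := by gcongr
    _ = _ := by ring

/-- The difference takes values in `[0, k - k']`: it is maximal where `u ≤ k'` and minimal where `u
≥ k`, so its derivative vanishes there. In between it coincides locally with `(k - u)₊`. -/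
theorem norm_fderiv_max_sub_sub_max_sub_le {u : E → ℝ} (hu : Continuous u) {k k' : ℝ}
    (hk : k' ≤ k) (x : E) :
    ‖fderiv ℝ (fun y => max (k - u y) 0 - max (k' - u y) 0) x‖ ≤
      {x | k' < u x ∧ u x < k}.indicator (fun x => ‖fderiv ℝ (fun y => max (k - u y) 0) x‖) x := by
  have hle : ∀ y, max (k - u y) 0 - max (k' - u y) 0 ≤ k - k' := fun y => by
    rw [sub_le_iff_le_add]
    refine max_le ?_ ?_
    · linarith [le_max_left (k' - u y) 0]
    · linarith [le_max_right (k' - u y) 0]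
  have hge : ∀ y, 0 ≤ max (k - u y) 0 - max (k' - u y) 0 := fun y =>
    sub_nonneg.2 (max_le_max_right 0 (by linarith))
  by_cases h1 : k' < u x
  · by_cases h2 : u x < k
    · rw [indicator_of_mem (show x ∈ {x | k' < u x ∧ u x < k} from ⟨h1, h2⟩)]
      refine le_of_eq (congrArg _ (Filter.EventuallyEq.fderiv_eq ?_))
      filter_upwards [(isOpen_lt continuous_const hu).mem_nhds h1] with y hy
      rw [max_eq_right (a := k' - u y) (sub_nonpos.2 (le_of_lt hy)), sub_zero]
    · rw [IsLocalMin.fderiv_eq_zero (Eventually.of_forall fun y => ?_), norm_zero]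
      · exact indicator_nonneg (fun _ _ => norm_nonneg _) _
      · refine le_trans (le_of_eq ?_) (hge y)
        rw [max_eq_right (by linarith), max_eq_right (by linarith), sub_zero]
  · rw [IsLocalMax.fderiv_eq_zero (Eventually.of_forall fun y => ?_), norm_zero]
    · exact indicator_nonneg (fun _ _ => norm_nonneg _) _
    · refine (hle y).trans (le_of_eq ?_)
      rw [max_eq_left (by linarith), max_eq_left (by linarith)]
      ring

/-- Removing `{u = 0}` is essential: these sets decrease to the empty set, while `{u < κ j}` alone
would decrease to a zero set not yet known to be null. -/
theorem tendsto_measureReal_sublevel_inter_pos {u : E → ℝ} (hu : Continuous u) {B : Set E}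
    (hB : MeasurableSet B) (hBt : volume B ≠ ⊤) {κ : ℕ → ℝ} (hκ : Antitone κ)
    (hκ0 : Tendsto κ atTop (𝓝 0)) :
    Tendsto (fun j => volume.real (B ∩ {x | 0 < u x ∧ u x < κ j})) atTop (𝓝 0) := by
  have hm : ∀ j, MeasurableSet (B ∩ {x | 0 < u x ∧ u x < κ j}) := fun j =>
    hB.inter ((measurableSet_lt measurable_const hu.measurable).inter
      (measurableSet_lt hu.measurable measurable_const))
  have h := tendsto_measure_iInter_atTop (μ := (volume : Measure E))
    (s := fun j => B ∩ {x | 0 < u x ∧ u x < κ j})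
    (fun j => (hm j).nullMeasurableSet)
    (fun i j hij x hx => ⟨hx.1, hx.2.1, hx.2.2.trans_le (hκ hij)⟩)
    ⟨0, ne_top_of_le_ne_top hBt (measure_mono inter_subset_left)⟩
  have he : ⋂ j, B ∩ {x | 0 < u x ∧ u x < κ j} = ∅ := by
    refine eq_empty_of_forall_notMem fun x hx => ?_
    rw [mem_iInter] at hx
    have h1 : 0 < u x := (hx 0).2.1
    have h2 : u x ≤ 0 := ge_of_tendsto' hκ0 fun j => (hx j).2.2.le
    linarith
  rw [he, measure_empty] at h
  exact (ENNReal.tendsto_toReal ENNReal.zero_ne_top).comp h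

/-- The measures of the sublevel sets of `u` tend to `0` if `u` is not a.e. small. -/
theorem HasTruncationEnergyBound.exists_sublevel_small {u : E → ℝ} {x₀ : E} {r : ℝ}
    {Λ σ : ℝ} (hr : 0 < r)
    (h : HasTruncationEnergyBound u (closedBall x₀ (4 * r)) Λ σ) (hΛ : 0 ≤ Λ) (hσ : 0 ≤ σ)
    {C : ℝ≥0} (hu : LipschitzWith C u) {k₀ : ℝ} (hk₀ : 0 < k₀)
    (hpos : volume (ball x₀ r ∩ {x | k₀ ≤ u x}) ≠ 0) {ε : ℝ} (hε : 0 < ε) :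
    ∃ k, 0 < k ∧ volume.real (ball x₀ r ∩ {x | u x < k}) ≤ ε := by
  have hKc : IsCompact (closedBall x₀ (4 * r)) := isCompact_closedBall _ _
  obtain ⟨φ, hφ, hφ0, hφ1, hφs, hφe⟩ := exists_lipschitz_cutoff x₀ (show 3 * r < 4 * r by linarith)
  set L : ℝ≥0 := max 1 (Real.toNNReal (1 / (4 * r - 3 * r)))
  have hφL : LipschitzWith L φ := hφ.weaken (le_max_right _ _)
  set c := volume.real (ball x₀ r ∩ {x | k₀ ≤ u x}) with hc
  have hbt : ∀ (s : ℝ) (S : Set E), volume (ball x₀ s ∩ S) ≠ ⊤ := fun s S =>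
    ne_top_of_le_ne_top measure_ball_lt_top.ne (measure_mono inter_subset_left)
  have hc0 : 0 < c := ENNReal.toReal_pos hpos (hbt _ _)
  set W := 2 * r * volume.real (ball (0 : E) (2 * r))
  have hW : 0 ≤ W := by positivity
  set Z := volume.real (closedBall x₀ (4 * r)) ^ σ
  have hZ : 0 ≤ Z := Real.rpow_nonneg measureReal_nonneg _
  -- The isoperimetric inequality is applied to the slice of `u` between `k / 2` and `k`, which
  -- vanishes on `{u ≥ k₀}`, a set of fixed measure `c` in the ball. Both sides scale like `k`, so
  -- `k` cancels. The inequality enlarges `r` to `3r`, and the cutoff `3r` to `4r`.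
  have key : ∀ k, 0 < k → k ≤ k₀ → volume.real (ball x₀ r ∩ {x | u x < k / 2}) ≤
      2 / c * W * √Λ * L *
        (volume.real (ball x₀ (3 * r) ∩ {x | 0 < u x ∧ u x < k}) * Z) ^ (1 / 2 : ℝ) := by
    intro k hk hkk
    set f : E → ℝ := fun y => max (k - u y) 0 - max (k / 2 - u y) 0 with hf
    have hfL : LipschitzWith (C + C) f :=
      (lipschitzWith_max_sub hu k).sub (lipschitzWith_max_sub hu (k / 2))
    set D := ball x₀ (3 * r) ∩ {x | k / 2 < u x ∧ u x < k} with hD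
    have hDm : MeasurableSet {x | k / 2 < u x ∧ u x < k} :=
      (measurableSet_lt measurable_const hu.continuous.measurable).inter
        (measurableSet_lt hu.continuous.measurable measurable_const)
    have hiso := hfL.mul_volume_mul_volume_le x₀ r (k / 2)
    have hfi : IntegrableOn (fun x => ‖fderiv ℝ f x‖) (ball x₀ (3 * r)) :=
      integrableOn_of_measurable_of_bound (measurable_fderiv ℝ f).norm measure_ball_lt_top.ne
        (C := (C + C : ℝ≥0)) fun x => by
          rw [abs_norm]; exact norm_fderiv_le_of_lipschitz ℝ hfL
    have hvi : IntegrableOn (fun x => ‖fderiv ℝ (fun y => max (k - u y) 0) x‖) (ball x₀ (3 * r)) :=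
      integrableOn_of_measurable_of_bound (measurable_fderiv ℝ _).norm measure_ball_lt_top.ne
        (C := C) fun x => by
          rw [abs_norm]; exact norm_fderiv_le_of_lipschitz ℝ (lipschitzWith_max_sub hu k)
    have e1 : k / 2 * (c * volume.real (ball x₀ r ∩ {x | u x < k / 2})) ≤
        W * ∫ x in ball x₀ (3 * r), ‖fderiv ℝ f x‖ := by
      have hfin : ∫⁻ x in ball x₀ (3 * r), ‖fderiv ℝ f x‖ₑ ≠ ⊤ := by
        have := hfi.2.ne
        simpa only [enorm_norm] using this
      have h2 := ENNReal.toReal_mono (by finiteness) hiso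
      rw [ENNReal.toReal_mul, ENNReal.toReal_mul, ENNReal.toReal_mul, ENNReal.toReal_mul,
        ENNReal.toReal_ofReal (by positivity), ENNReal.toReal_ofReal (by positivity),
        ← integral_norm_eq_lintegral_enorm (measurable_fderiv ℝ f).aestronglyMeasurable] at h2
      refine le_trans ?_ h2
      refine mul_le_mul_of_nonneg_left (mul_le_mul ?_ ?_ measureReal_nonneg measureReal_nonneg)
        (by positivity)
      · refine measureReal_mono (inter_subset_inter_right _ fun x hx => ?_) (hbt _ _)
        have hx' : k₀ ≤ u x := hx
        change max (k - u x) 0 - max (k / 2 - u x) 0 ≤ 0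
        rw [max_eq_right (by linarith), max_eq_right (by linarith), sub_zero]
      · refine measureReal_mono (inter_subset_inter_right _ fun x hx => ?_) (hbt _ _)
        have hx' : u x < k / 2 := hx
        change k / 2 ≤ max (k - u x) 0 - max (k / 2 - u x) 0
        rw [max_eq_left (by linarith), max_eq_left (by linarith)]
        linarith
    have e2 : ∫ x in ball x₀ (3 * r), ‖fderiv ℝ f x‖ ≤
        ∫ x in D, φ x * ‖fderiv ℝ (fun y => max (k - u y) 0) x‖ := by
      rw [hD, ← setIntegral_indicator hDm]
      refine setIntegral_mono_on hfi ?_ measurableSet_ball fun x hx => ?_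
      · refine (hvi.indicator hDm).congr ?_
        filter_upwards [ae_restrict_mem measurableSet_ball] with x hx
        by_cases hxD : x ∈ {x | k / 2 < u x ∧ u x < k}
        · simp only [indicator_of_mem hxD]
          rw [hφe x (ball_subset_closedBall hx), one_mul]
        · simp only [indicator_of_notMem hxD]
      · refine (norm_fderiv_max_sub_sub_max_sub_le hu.continuous (by linarith) x).trans (le_of_eq ?_)
        by_cases hxD : x ∈ {x | k / 2 < u x ∧ u x < k}
        · simp only [indicator_of_mem hxD]
          rw [hφe x (ball_subset_closedBall hx), one_mul]
        · simp only [indicator_of_notMem hxD]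
    have hDK : D ⊆ closedBall x₀ (4 * r) := inter_subset_left.trans
      (ball_subset_closedBall.trans (closedBall_subset_closedBall (by linarith)))
    have e3 := h.setIntegral_le hΛ hu hk.le hKc Subset.rfl hφL hφ0 hφ1 hφs (le_max_left _ _) hDK
    have e4 : (volume.real D * volume.real (closedBall x₀ (4 * r) ∩ {x | u x < k}) ^ σ) ^
        (1 / 2 : ℝ) ≤ (volume.real (ball x₀ (3 * r) ∩ {x | 0 < u x ∧ u x < k}) * Z) ^
        (1 / 2 : ℝ) := by
      refine Real.rpow_le_rpow (mul_nonneg measureReal_nonneg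
        (Real.rpow_nonneg measureReal_nonneg _)) ?_ (by norm_num)
      refine mul_le_mul ?_ ?_ (Real.rpow_nonneg measureReal_nonneg _) measureReal_nonneg
      · refine measureReal_mono (inter_subset_inter_right _ fun x hx => ⟨?_, hx.2⟩) (hbt _ _)
        exact lt_trans (by positivity) hx.1
      · exact Real.rpow_le_rpow measureReal_nonneg
          (measureReal_mono inter_subset_left hKc.measure_lt_top.ne) hσ
    set Y := (volume.real (ball x₀ (3 * r) ∩ {x | 0 < u x ∧ u x < k}) * Z) ^ (1 / 2 : ℝ)
    have e5 : k / 2 * (c * volume.real (ball x₀ r ∩ {x | u x < k / 2})) ≤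
        W * (√Λ * (k * L) * Y) :=
      e1.trans (mul_le_mul_of_nonneg_left (e2.trans (e3.trans
        (mul_le_mul_of_nonneg_left e4 (by positivity)))) hW)
    have e6 : k / 2 * (c * (2 / c * W * √Λ * L * Y)) = W * (√Λ * (k * L) * Y) := by
      field_simp
    rw [← e6] at e5
    exact le_of_mul_le_mul_left (le_of_mul_le_mul_left e5 (by positivity)) hc0
  have hκ : Antitone fun j : ℕ => k₀ / ((j : ℝ) + 1) := fun i j hij => by
    have : (i : ℝ) ≤ j := by exact_mod_cast hij
    simp only
    gcongr
  have hκ0 : Tendsto (fun j : ℕ => k₀ / ((j : ℝ) + 1)) atTop (𝓝 0) := by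
    simpa [div_eq_mul_one_div k₀] using
      (tendsto_one_div_add_atTop_nhds_zero_nat (𝕜 := ℝ)).const_mul k₀
  have hlim := tendsto_measureReal_sublevel_inter_pos hu.continuous
    (B := ball x₀ (3 * r)) measurableSet_ball measure_ball_lt_top.ne hκ hκ0
  have hlim2 : Tendsto (fun j : ℕ => 2 / c * W * √Λ * L *
      (volume.real (ball x₀ (3 * r) ∩ {x | 0 < u x ∧ u x < k₀ / ((j : ℝ) + 1)}) * Z) ^
        (1 / 2 : ℝ)) atTop (𝓝 0) := by
    have := ((hlim.mul_const Z).rpow_const (p := (1 / 2 : ℝ)) (Or.inr (by norm_num))).const_mul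
      (2 / c * W * √Λ * L)
    rwa [zero_mul, Real.zero_rpow (by norm_num), mul_zero] at this
  obtain ⟨j, hj⟩ := (hlim2.eventually (ge_mem_nhds hε)).exists
  have hj0 : (0 : ℝ) < (j : ℝ) + 1 := by positivity
  refine ⟨k₀ / ((j : ℝ) + 1) / 2, by positivity, (key _ (by positivity) ?_).trans hj⟩
  exact div_le_self hk₀.le (by linarith [(Nat.cast_nonneg j : (0 : ℝ) ≤ j)])

end DeGiorgi

/-- Fast geometric convergence. -/
theorem exists_pos_forall_tendsto_zero_of_le_rpow {C D δ : ℝ} (hC : 0 < C) (hD : 1 < D)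
    (hδ : 0 < δ) : ∃ ε : ℝ, 0 < ε ∧ ∀ x : ℕ → ℝ, (∀ j, 0 ≤ x j) →
      (∀ j, x (j + 1) ≤ C * D ^ j * x j ^ (1 + δ)) → x 0 ≤ ε → Tendsto x atTop (𝓝 0) := by
  have hD0 : 0 < D := zero_lt_one.trans hD
  -- The choices `D l^δ = 1` and `C ε^δ = l` make the bound `x j ≤ ε l^j` reproduce itself under the
  -- recursion.
  set l : ℝ := D ^ (-(1 / δ)) with hl
  have hl0 : 0 < l := Real.rpow_pos_of_pos hD0 _
  have hl1 : l < 1 := Real.rpow_lt_one_of_one_lt_of_neg hD (by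
    have : 0 < 1 / δ := by positivity
    linarith)
  have hlδ : D * l ^ δ = 1 := by
    rw [hl, ← Real.rpow_mul hD0.le, neg_mul, one_div_mul_cancel hδ.ne', Real.rpow_neg_one,
      mul_inv_cancel₀ hD0.ne']
  set ε : ℝ := (l / C) ^ (1 / δ) with hε
  have hε0 : 0 < ε := Real.rpow_pos_of_pos (by positivity) _
  have hεδ : C * ε ^ δ = l := by
    rw [hε, ← Real.rpow_mul (by positivity), one_div_mul_cancel hδ.ne', Real.rpow_one]
    field_simp
  refine ⟨ε, hε0, fun x hx0 hx hxε => ?_⟩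
  have hb : ∀ j, x j ≤ ε * l ^ j := by
    intro j
    induction j with
    | zero => simpa using hxε
    | succ j ih =>
      have hlj : 0 < l ^ j := by positivity
      have e1 : x j ^ (1 + δ) ≤ (ε * l ^ j) ^ (1 + δ) :=
        Real.rpow_le_rpow (hx0 j) ih (by linarith)
      have e2 : (ε * l ^ j) ^ (1 + δ) = ε * l ^ j * (ε ^ δ * (l ^ δ) ^ j) := by
        rw [Real.rpow_add (by positivity), Real.rpow_one, Real.mul_rpow hε0.le hlj.le,
          ← Real.rpow_natCast l j, ← Real.rpow_natCast (l ^ δ) j, ← Real.rpow_mul hl0.le,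
          ← Real.rpow_mul hl0.le, mul_comm (j : ℝ) δ]
      calc x (j + 1) ≤ C * D ^ j * x j ^ (1 + δ) := hx j
        _ ≤ C * D ^ j * (ε * l ^ j * (ε ^ δ * (l ^ δ) ^ j)) := by
            rw [← e2]; exact mul_le_mul_of_nonneg_left e1 (by positivity)
        _ = ε * l ^ j * (C * ε ^ δ) * (D * l ^ δ) ^ j := by rw [mul_pow]; ring
        _ = ε * l ^ (j + 1) := by rw [hlδ, hεδ, one_pow, pow_succ]; ring
  refine squeeze_zero hx0 hb ?_
  simpa using (tendsto_pow_atTop_nhds_zero_of_lt_one hl0.le hl1).const_mul ε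

/-! ### De Giorgi iteration -/

section DeGiorgi

variable {n : ℕ}

local notation "E" => EuclideanSpace ℝ (Fin n)

/-- One iteration step: the `L¹` Sobolev inequality for `(k - u)₊ φ`, which is at least `k - k'` on
the smaller set. The energy bound and Cauchy–Schwarz give `φ |Dv|` the power `(1 + σ) / 2` of the
measure; the term with `Dφ` is linear in the measure and is lowered to that power. The condition `ρ'
- ρ ≤ 1` makes the cutoff constant at least `1`. -/
theorem HasTruncationEnergyBound.measureReal_sublevel_le {u : E → ℝ} {K₀ : Set E} {Λ σ : ℝ}
    (h : HasTruncationEnergyBound u K₀ Λ σ) (hK₀ : IsCompact K₀) (hΛ : 0 ≤ Λ) (hσ : 0 ≤ σ)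
    (hσ1 : σ ≤ 1) {C : ℝ≥0} (hu : LipschitzWith C u) (hu0 : ∀ x, 0 ≤ u x) {p : ℝ}
    (hp : Real.HolderConjugate n p) {x₀ : E} {ρ ρ' k k' : ℝ} (hρ : ρ < ρ') (hρ1 : ρ' - ρ ≤ 1)
    (hρK : closedBall x₀ ρ' ⊆ K₀) (hk : 0 ≤ k) (hk' : k' ≤ k) :
    (k - k') ^ p * volume.real (closedBall x₀ ρ ∩ {x | u x < k'}) ≤
      lintegralPowLePowLIntegralFDerivConst (volume : Measure E) p *
        (k / (ρ' - ρ) * (√Λ + volume.real K₀ ^ ((1 - σ) / 2)) *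
          volume.real (closedBall x₀ ρ' ∩ {x | u x < k}) ^ ((1 + σ) / 2)) ^ p := by
  obtain ⟨φ, hφ, hφ0, hφ1, hφs, hφe⟩ := exists_lipschitz_cutoff x₀ hρ
  set L : ℝ≥0 := Real.toNNReal (1 / (ρ' - ρ)) with hL
  have hρpos : 0 < ρ' - ρ := sub_pos.2 hρ
  have hLr : (L : ℝ) = 1 / (ρ' - ρ) := Real.coe_toNNReal _ (by positivity)
  have hL1 : 1 ≤ L := by
    rw [← NNReal.coe_le_coe, hLr, NNReal.coe_one, le_div_iff₀ hρpos]
    linarith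
  have hp0 : 0 ≤ p := hp.symm.nonneg
  set v : E → ℝ := fun y => max (k - u y) 0 with hv
  have hvL : LipschitzWith C v := lipschitzWith_max_sub hu k
  have hv0 : ∀ x, 0 ≤ v x := fun x => le_max_right _ _
  have hvk : ∀ x, v x ≤ k := fun x => max_le (by linarith [hu0 x]) hk
  obtain ⟨C1, hC1⟩ := hvL.exists_mul hφ (A := k) (B := 1)
    (fun x => by rw [abs_of_nonneg (hv0 x)]; exact hvk x)
    (fun x => by rw [abs_of_nonneg (hφ0 x)]; exact hφ1 x)
  set f : E → ℝ := fun x => v x * φ x with hf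
  have hf0 : ∀ x, 0 ≤ f x := fun x => mul_nonneg (hv0 x) (hφ0 x)
  have hfφ : Function.support f ⊆ Function.support φ := fun x hx h => hx (by simp [hf, h])
  have hfs : tsupport f ⊆ closedBall x₀ ρ' := (closure_mono hfφ).trans hφs
  have hfc : HasCompactSupport f :=
    (isCompact_closedBall x₀ ρ').of_isClosed_subset (isClosed_tsupport _) hfs
  set A := closedBall x₀ ρ' ∩ {x | u x < k} with hA
  have hAm : MeasurableSet A :=
    measurableSet_closedBall.inter (measurableSet_lt hu.continuous.measurable measurable_const)
  have hAt : volume A ≠ ⊤ :=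
    ne_top_of_le_ne_top measure_closedBall_lt_top.ne (measure_mono inter_subset_left)
  set S := closedBall x₀ ρ ∩ {x | u x < k'} with hS
  have hSm : MeasurableSet S :=
    measurableSet_closedBall.inter (measurableSet_lt hu.continuous.measurable measurable_const)
  have hsob := hC1.lintegral_pow_le_pow_lintegral_fderiv hfc (p := p)
    (by rwa [finrank_euclideanSpace_fin])
  have hleft : ENNReal.ofReal (k - k') ^ p * volume S ≤ ∫⁻ x, ‖f x‖ₑ ^ p := by
    rw [← setLIntegral_const]
    refine (setLIntegral_mono' hSm fun x hx => ?_).trans (setLIntegral_le_lintegral S _)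
    refine ENNReal.rpow_le_rpow ?_ hp0
    rw [← ofReal_norm, Real.norm_of_nonneg (hf0 x)]
    refine ENNReal.ofReal_le_ofReal ?_
    have hx2 : u x < k' := hx.2
    rw [hf]
    simp only
    rw [hφe x hx.1, mul_one]
    exact (by linarith : k - k' ≤ k - u x).trans (le_max_left _ _)
  have hgm : Measurable fun x => φ x * ‖fderiv ℝ v x‖ :=
    hφ.continuous.measurable.mul (measurable_fderiv ℝ v).norm
  have hgi : IntegrableOn (fun x => φ x * ‖fderiv ℝ v x‖) A :=
    integrableOn_of_measurable_of_bound hgm hAt (C := C) fun x => by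
      rw [abs_of_nonneg (mul_nonneg (hφ0 x) (norm_nonneg _))]
      exact (mul_le_of_le_one_left (norm_nonneg _) (hφ1 x)).trans
        (norm_fderiv_le_of_lipschitz ℝ hvL)
  have hgI : IntegrableOn (fun x => φ x * ‖fderiv ℝ v x‖ + k * L) A :=
    hgi.add (integrableOn_const hAt)
  have hright : ∫⁻ x, ‖fderiv ℝ f x‖ₑ ≤
      ENNReal.ofReal (∫ x in A, (φ x * ‖fderiv ℝ v x‖ + k * L)) := by
    have hnn : ∀ x, 0 ≤ φ x * ‖fderiv ℝ v x‖ + k * L := fun x =>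
      add_nonneg (mul_nonneg (hφ0 x) (norm_nonneg _)) (mul_nonneg hk L.2)
    rw [ofReal_integral_eq_lintegral_ofReal hgI (Eventually.of_forall hnn),
      ← lintegral_indicator hAm]
    refine lintegral_mono_ae ?_
    filter_upwards [hvL.ae_differentiableAt, hφ.ae_differentiableAt] with x hvx hφx
    by_cases hxA : x ∈ A
    · rw [indicator_of_mem hxA, ← ofReal_norm]
      refine ENNReal.ofReal_le_ofReal ?_
      have : HasFDerivAt f _ x := hvx.hasFDerivAt.mul hφx.hasFDerivAt
      rw [this.fderiv, add_comm]
      refine (norm_add_le _ _).trans (add_le_add ?_ ?_)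
      · rw [norm_smul, Real.norm_of_nonneg (hφ0 x)]
      · rw [norm_smul, Real.norm_of_nonneg (hv0 x)]
        exact mul_le_mul (hvk x) (norm_fderiv_le_of_lipschitz ℝ hφ) (norm_nonneg _) hk
    · have hfx : f x = 0 := by
        by_cases hx1 : x ∈ closedBall x₀ ρ'
        · have hx2 : k ≤ u x := not_lt.1 fun h => hxA ⟨hx1, h⟩
          simp [hf, hv, hx2]
        · exact image_eq_zero_of_notMem_tsupport fun h => hx1 (hfs h)
      rw [IsLocalMin.fderiv_eq_zero (Eventually.of_forall fun y => ?_)]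
      · rw [← ofReal_norm, norm_zero, ENNReal.ofReal_zero]; exact zero_le
      · rw [hfx]; exact hf0 y
  set X := volume.real A
  have hX0 : 0 ≤ X := measureReal_nonneg
  have hI : ∫ x in A, (φ x * ‖fderiv ℝ v x‖ + k * L) ≤
      k / (ρ' - ρ) * (√Λ + volume.real K₀ ^ ((1 - σ) / 2)) * X ^ ((1 + σ) / 2) := by
    rw [integral_add hgi (integrableOn_const hAt), setIntegral_const, smul_eq_mul]
    have e1 := h.setIntegral_le hΛ hu hk (isCompact_closedBall x₀ ρ') hρK hφ hφ0 hφ1 hφs hL1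
      (S := A) inter_subset_left
    have e2 : (X * X ^ σ) ^ (1 / 2 : ℝ) = X ^ ((1 + σ) / 2) := by
      nth_rewrite 1 [← Real.rpow_one X]
      rw [← Real.rpow_add_of_nonneg hX0 zero_le_one hσ, ← Real.rpow_mul hX0]
      congr 1
      ring
    rw [e2] at e1
    have e3 : X ≤ volume.real K₀ ^ ((1 - σ) / 2) * X ^ ((1 + σ) / 2) := by
      have := measureReal_le_rpow_mul_rpow (S := A) (inter_subset_left.trans hρK)
        hK₀.measure_lt_top.ne (by linarith : 0 ≤ (1 + σ) / 2)
        (by linarith : (1 + σ) / 2 ≤ (1 : ℝ))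
      rw [Real.rpow_one] at this
      convert this using 3
      ring
    have e4 : k / (ρ' - ρ) = k * L := by rw [hLr]; ring
    rw [e4]
    have e5 := mul_le_mul_of_nonneg_right e3 (mul_nonneg hk L.2)
    calc _ ≤ √Λ * (k * L) * X ^ ((1 + σ) / 2) +
          volume.real K₀ ^ ((1 - σ) / 2) * X ^ ((1 + σ) / 2) * (k * L) := add_le_add e1 e5
      _ = _ := by ring
  have hfinal : ENNReal.ofReal (k - k') ^ p * volume S ≤
      lintegralPowLePowLIntegralFDerivConst (volume : Measure E) p *
        ENNReal.ofReal (k / (ρ' - ρ) * (√Λ + volume.real K₀ ^ ((1 - σ) / 2)) *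
          X ^ ((1 + σ) / 2)) ^ p := by
    refine (hleft.trans hsob).trans (mul_le_mul_right ?_ _)
    exact ENNReal.rpow_le_rpow (hright.trans (ENNReal.ofReal_le_ofReal hI)) hp0
  have hnn : 0 ≤ k / (ρ' - ρ) * (√Λ + volume.real K₀ ^ ((1 - σ) / 2)) * X ^ ((1 + σ) / 2) := by
    positivity
  have := ENNReal.toReal_mono (ENNReal.mul_ne_top ENNReal.coe_ne_top
    (ENNReal.rpow_ne_top_of_nonneg hp0 ENNReal.ofReal_ne_top)) hfinal
  rwa [ENNReal.toReal_mul, ENNReal.toReal_mul, ← ENNReal.toReal_rpow, ← ENNReal.toReal_rpow,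
    ENNReal.toReal_ofReal (by linarith), ENNReal.toReal_ofReal hnn, ENNReal.coe_toReal] at this

/-- De Giorgi's lemma: if a sublevel set `{u < k}` has small measure, then `u ≥ k / 2` at the
centre of the ball. -/
theorem HasTruncationEnergyBound.exists_pos_forall_half_le {u : E → ℝ} {x₀ : E} {R : ℝ}
    {Λ σ : ℝ} (hR : 0 < R) (hR1 : R ≤ 1)
    (h : HasTruncationEnergyBound u (closedBall x₀ (2 * R)) Λ σ) (hΛ : 0 ≤ Λ) (hσ : 0 ≤ σ)
    (hσ1 : σ ≤ 1) {C : ℝ≥0} (hu : LipschitzWith C u) (hu0 : ∀ x, 0 ≤ u x) {p : ℝ}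
    (hp : Real.HolderConjugate n p) (hpσ : 1 < (1 + σ) / 2 * p) :
    ∃ ε : ℝ, 0 < ε ∧ ∀ k, 0 < k →
      volume.real (closedBall x₀ (2 * R) ∩ {x | u x < k}) ≤ ε → k / 2 ≤ u x₀ := by
  set K₀ := closedBall x₀ (2 * R) with hK₀
  set M := √Λ + volume.real K₀ ^ ((1 - σ) / 2) with hM
  have hM0 : 0 ≤ M := add_nonneg (Real.sqrt_nonneg _) (Real.rpow_nonneg measureReal_nonneg _)
  set Cs : ℝ := ((lintegralPowLePowLIntegralFDerivConst (volume : Measure E) p : ℝ≥0) : ℝ)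
  have hCs0 : 0 ≤ Cs := NNReal.coe_nonneg _
  have hp0 : 0 < p := hp.symm.pos
  -- The summand `1` only makes the constant positive. Nothing here involves `k`, so `ε` serves all
  -- levels.
  obtain ⟨ε, hε, hconv⟩ := exists_pos_forall_tendsto_zero_of_le_rpow
    (C := Cs * (8 / R * M) ^ p + 1) (D := 4 ^ p) (δ := (1 + σ) / 2 * p - 1) (by positivity)
    (Real.one_lt_rpow (by norm_num) hp0) (by linarith)
  refine ⟨ε, hε, fun k hk hkε => ?_⟩
  -- Radii decrease from `2R` to `R`, levels from `k` to `k / 2`.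
  set r : ℕ → ℝ := fun j => R * (1 + (1 / 2) ^ j) with hr
  set κ : ℕ → ℝ := fun j => k / 2 * (1 + (1 / 2) ^ j) with hκ
  have hpow : ∀ j : ℕ, (0 : ℝ) < (1 / 2) ^ j := fun j => by positivity
  have hpow1 : ∀ j : ℕ, ((1 : ℝ) / 2) ^ j ≤ 1 := fun j => pow_le_one₀ (by norm_num) (by norm_num)
  set x : ℕ → ℝ := fun j => volume.real (closedBall x₀ (r j) ∩ {y | u y < κ j}) with hx
  have hx0 : ∀ j, 0 ≤ x j := fun j => measureReal_nonneg
  have hr2 : ∀ j, r j ≤ 2 * R := fun j => by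
    simp only [hr]; nlinarith [hpow1 j]
  have hstep : ∀ j, x (j + 1) ≤ (Cs * (8 / R * M) ^ p + 1) * (4 ^ p) ^ j *
      x j ^ (1 + ((1 + σ) / 2 * p - 1)) := by
    intro j
    have hrd : r j - r (j + 1) = R * (1 / 2) ^ (j + 1) := by simp only [hr]; ring
    have hκd : κ j - κ (j + 1) = k / 2 * (1 / 2) ^ (j + 1) := by simp only [hκ]; ring
    have hκ0 : 0 ≤ κ j := by have := hpow j; simp only [hκ]; positivity
    have hκk : κ j ≤ k := by simp only [hκ]; nlinarith [hpow1 j]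
    have hrpos : 0 < r j - r (j + 1) := by rw [hrd]; have := hpow (j + 1); positivity
    have e := h.measureReal_sublevel_le (isCompact_closedBall _ _) hΛ hσ hσ1 hu hu0 hp
      (x₀ := x₀) (ρ := r (j + 1)) (ρ' := r j) (k := κ j) (k' := κ (j + 1)) (by linarith)
      (by rw [hrd]; exact mul_le_one₀ hR1 (hpow _).le (hpow1 _))
      (closedBall_subset_closedBall (hr2 j)) hκ0
      (by have := hpow (j + 1); have : 0 ≤ k / 2 * (1 / 2) ^ (j + 1) := by positivity
          linarith)
    change _ * x (j + 1) ≤ Cs * (_ * M * x j ^ _) ^ p at e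
    have hkd0 : 0 < κ j - κ (j + 1) := by rw [hκd]; have := hpow (j + 1); positivity
    have hXt : 0 ≤ x j ^ ((1 + σ) / 2) := Real.rpow_nonneg (hx0 j) _
    -- Writing the bound as a multiple of the level gap lets that gap cancel from the recursion,
    -- which frees it of `k`.
    have hratio : κ j / (r j - r (j + 1)) ≤ (κ j - κ (j + 1)) * (8 / R * 4 ^ j) := by
      rw [div_le_iff₀ hrpos, hκd, hrd]
      have : k / 2 * (1 / 2) ^ (j + 1) * (8 / R * 4 ^ j) * (R * (1 / 2) ^ (j + 1)) =
          k * ((1 / 2) ^ j * (1 / 2) ^ j * 4 ^ j) := by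
        field_simp; ring
      rw [this, ← mul_pow, ← mul_pow]
      norm_num
      exact hκk
    have e2 : (κ j / (r j - r (j + 1)) * M * x j ^ ((1 + σ) / 2)) ^ p ≤
        ((κ j - κ (j + 1)) * ((8 / R * M) * 4 ^ j * x j ^ ((1 + σ) / 2))) ^ p := by
      refine Real.rpow_le_rpow (by positivity) ?_ hp0.le
      calc _ ≤ (κ j - κ (j + 1)) * (8 / R * 4 ^ j) * M * x j ^ ((1 + σ) / 2) := by gcongr
        _ = _ := by ring
    have e3 : ((κ j - κ (j + 1)) * ((8 / R * M) * 4 ^ j * x j ^ ((1 + σ) / 2))) ^ p =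
        (κ j - κ (j + 1)) ^ p * ((8 / R * M) ^ p * (4 ^ p) ^ j * x j ^ ((1 + σ) / 2 * p)) := by
      rw [Real.mul_rpow hkd0.le (by positivity), Real.mul_rpow (by positivity) hXt,
        Real.mul_rpow (by positivity) (by positivity), ← Real.rpow_mul (hx0 j),
        ← Real.rpow_natCast, ← Real.rpow_natCast, ← Real.rpow_mul (by norm_num),
        ← Real.rpow_mul (by norm_num), mul_comm (j : ℝ) p]
    have e4 : (κ j - κ (j + 1)) ^ p * x (j + 1) ≤ (κ j - κ (j + 1)) ^ p *
        (Cs * (8 / R * M) ^ p * (4 ^ p) ^ j * x j ^ ((1 + σ) / 2 * p)) := by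
      refine e.trans ((mul_le_mul_of_nonneg_left (e2.trans_eq e3) hCs0).trans (le_of_eq ?_))
      ring
    have e5 := le_of_mul_le_mul_left e4 (Real.rpow_pos_of_pos hkd0 p)
    rw [add_sub_cancel]
    refine e5.trans ?_
    have hXp : 0 ≤ x j ^ ((1 + σ) / 2 * p) := Real.rpow_nonneg (hx0 j) _
    gcongr
    linarith
  have hlim := hconv x hx0 hstep (by
    have e1 : r 0 = 2 * R := by simp only [hr, pow_zero]; ring
    have e2 : κ 0 = k := by simp only [hκ, pow_zero]; ring
    simpa only [hx, e1, e2] using hkε)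
  by_contra hcon
  rw [not_le] at hcon
  -- If `u x₀ < k / 2`, then `U` is a nonempty open set contained in every set of the iteration, so
  -- their measures cannot tend to zero.
  set U := ball x₀ R ∩ {y | u y < k / 2} with hU
  have hUo : IsOpen U := isOpen_ball.inter (isOpen_lt hu.continuous continuous_const)
  have hUne : U.Nonempty := ⟨x₀, mem_ball_self hR, hcon⟩
  have hUpos : 0 < volume.real U := ENNReal.toReal_pos (hUo.measure_pos _ hUne).ne'
    (ne_top_of_le_ne_top measure_ball_lt_top.ne (measure_mono inter_subset_left))
  have hUle : ∀ j, volume.real U ≤ x j := fun j => by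
    refine measureReal_mono (fun y hy => ⟨?_, ?_⟩)
      (ne_top_of_le_ne_top measure_closedBall_lt_top.ne (measure_mono inter_subset_left))
    · refine closedBall_subset_closedBall ?_ (ball_subset_closedBall hy.1)
      simp only [hr]; nlinarith [hpow j]
    · have h1 : u y < k / 2 := hy.2
      change u y < k / 2 * (1 + (1 / 2) ^ j)
      nlinarith [hpow j]
  exact absurd (ge_of_tendsto' hlim hUle) (not_le.2 hUpos)

end DeGiorgi

/-! ### The strong maximum principle -/

section MaximumPrinciple

variable {n : ℕ}

local notation "E" => EuclideanSpace ℝ (Fin n)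

/-- Only derivatives of `V` on the open set `Ω` enter the inequality, so `V` may be replaced by a
globally Lipschitz function. -/
theorem IsLipschitzSupersolution.of_eqOn_sub_const {a : E → Matrix (Fin n) (Fin n) ℝ} {b : E → E}
    {Ω : Set E} (hΩ : IsOpen Ω) {V u : E → ℝ} (hV : IsLipschitzSupersolution a b Ω V)
    {C : ℝ≥0} (hu : LipschitzWith C u) {c : ℝ} (huV : ∀ x ∈ Ω, u x = V x - c) :
    IsLipschitzSupersolution a b Ω u := by
  refine ⟨⟨C, hu.lipschitzOnWith⟩, fun η hη hηc hηs hη0 => ?_⟩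
  refine (hV.2 η hη hηc hηs hη0).trans_eq (setIntegral_congr_fun hΩ.measurableSet fun x hx => ?_)
  have : fderiv ℝ u x = fderiv ℝ V x := by
    have h : u =ᶠ[𝓝 x] fun y => V y - c := by
      filter_upwards [hΩ.mem_nhds hx] with y hy using huV y hy
    rw [h.fderiv_eq, fderiv_sub_const]
  simp only [partialD, this]

theorem eqOn_zero_ball_of_volume_eq_zero {u : E → ℝ} (hu : Continuous u) (hu0 : ∀ x, 0 ≤ u x)
    {x₀ : E} {r : ℝ} (h : ∀ k, 0 < k → volume (ball x₀ r ∩ {x | k ≤ u x}) = 0) :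
    ∀ x ∈ ball x₀ r, u x = 0 := by
  intro x hx
  by_contra hne
  have hpos : 0 < u x := lt_of_le_of_ne (hu0 x) (Ne.symm hne)
  have hU : IsOpen (ball x₀ r ∩ {y | u x / 2 < u y}) :=
    isOpen_ball.inter (isOpen_lt continuous_const hu)
  have h1 := hU.measure_pos volume ⟨x, hx, by change u x / 2 < u x; linarith⟩
  have h2 : volume (ball x₀ r ∩ {y | u x / 2 < u y}) ≤ volume (ball x₀ r ∩ {y | u x / 2 ≤ u y}) :=
    measure_mono (inter_subset_inter_right _ fun y (hy : u x / 2 < u y) => hy.le)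
  rw [h _ (by positivity)] at h2
  exact absurd h1 (not_lt.2 h2)

/-- A nonnegative supersolution which vanishes at a point vanishes around it. -/
theorem IsLipschitzSupersolution.eventually_eq_zero (hn : 2 ≤ n)
    {a : E → Matrix (Fin n) (Fin n) ℝ} {b : E → E} {Ω : Set E} (hΩ : IsOpen Ω) {ν : ℝ} (hν : 0 < ν)
    (ha_loc : ∀ i j, MemLpLoc (fun x => a x i j) ⊤ Ω) (ha : UniformlyElliptic ν a Ω)
    {q : ℝ} (hq : (n : ℝ) / 2 < q) (hb : MemLpLoc b (ENNReal.ofReal q) Ω)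
    (hdiv : DivNonposDistrib b Ω) {u : E → ℝ} {C : ℝ≥0} (huL : LipschitzWith C u)
    (hu : IsLipschitzSupersolution a b Ω u) (hu0 : ∀ x, 0 ≤ u x) {x₀ : E} (hx₀ : x₀ ∈ Ω)
    (hux₀ : u x₀ = 0) : ∀ᶠ x in 𝓝 x₀, u x = 0 := by
  have hn' : (2 : ℝ) ≤ n := by exact_mod_cast hn
  have hq1 : 1 < q := by linarith
  obtain ⟨ρ, hρ, hρΩ⟩ := Metric.isOpen_iff.1 hΩ x₀ hx₀
  -- The ball of radius `12R = 4 · 3R` must lie in `Ω`; `R ≤ 1` is required by the iteration.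
  set R := min 1 (ρ / 16) with hR
  have hR0 : 0 < R := lt_min one_pos (by positivity)
  have hRρ : 12 * R < ρ := by
    have : R ≤ ρ / 16 := min_le_right _ _
    linarith
  have hKΩ : closedBall x₀ (12 * R) ⊆ Ω := (closedBall_subset_ball hRρ).trans hρΩ
  obtain ⟨Λ, hΛ, hE⟩ := hu.exists_hasTruncationEnergyBound hΩ hν ha_loc ha hq1.le hb hdiv huL hu0
    (isCompact_closedBall x₀ (12 * R)) hKΩ
  have hmono : ∀ s ≤ 12 * R, HasTruncationEnergyBound u (closedBall x₀ s) Λ (1 - 1 / q) :=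
    fun s hs k hk K hK hKs => hE k hk K hK (hKs.trans (closedBall_subset_closedBall hs))
  have hq0 : 0 < 1 / q := by positivity
  have hqle : 1 / q ≤ 1 := by rw [div_le_one (by linarith)]; exact hq1.le
  have hp := Real.HolderConjugate.conjExponent (p := (n : ℝ)) (by linarith)
  -- With Sobolev exponent `n / (n - 1)`, this is equivalent to `n / q < 2`.
  have hpσ : 1 < (1 + (1 - 1 / q)) / 2 * Real.conjExponent n := by
    rw [Real.conjExponent, ← mul_div_assoc, lt_div_iff₀ (by linarith)]
    have : (n : ℝ) * (1 / q) < 2 := by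
      rw [mul_one_div, div_lt_iff₀ (by linarith)]
      linarith
    linarith
  obtain ⟨ε, hε, hdg⟩ := (hmono (2 * R) (by linarith)).exists_pos_forall_half_le hR0
    (min_le_left _ _) hΛ (by linarith) (by linarith) huL hu0 hp hpσ
  have hzero : ∀ k, 0 < k → volume (ball x₀ (3 * R) ∩ {x | k ≤ u x}) = 0 := by
    intro k hk
    by_contra hne
    obtain ⟨k', hk', hsmall⟩ := (hmono (4 * (3 * R)) (by linarith)).exists_sublevel_small
      (by positivity) hΛ (by linarith) huL hk hne hε
    have := hdg k' hk' (le_trans (measureReal_mono (inter_subset_inter_left _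
      (closedBall_subset_ball (by linarith))) (ne_top_of_le_ne_top measure_ball_lt_top.ne
        (measure_mono inter_subset_left))) hsmall)
    rw [hux₀] at this
    linarith
  filter_upwards [ball_mem_nhds x₀ (by positivity : 0 < 3 * R)] with x hx using
    eqOn_zero_ball_of_volume_eq_zero huL.continuous hu0 hzero x hx

end MaximumPrinciple

theorem corollary2p2 (n : ℕ) (hn : 2 ≤ n)
    (Ω : Set (EuclideanSpace ℝ (Fin n))) (hΩ : IsOpen Ω) (hΩc : IsConnected Ω)
    (ν : ℝ) (hν : 0 < ν)
    (a : EuclideanSpace ℝ (Fin n) → Matrix (Fin n) (Fin n) ℝ)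
    (ha_loc : ∀ i j, MemLpLoc (fun x => a x i j) ⊤ Ω)
    (ha : UniformlyElliptic ν a Ω)
    (q : ℝ) (hq : (n : ℝ) / 2 < q) (hqn : q ≤ n)
    (b : EuclideanSpace ℝ (Fin n) → EuclideanSpace ℝ (Fin n))
    (hb : MemLpLoc b (ENNReal.ofReal q) Ω)
    (hdiv : DivNonposDistrib b Ω)
    (V : EuclideanSpace ℝ (Fin n) → ℝ)
    (hV : IsLipschitzSupersolution a b Ω V)
    (hV_nonconst : ¬ ∃ c : ℝ, ∀ x ∈ Ω, V x = c) :
    ¬ ∃ x₀ ∈ Ω, ∀ x ∈ Ω, V x₀ ≤ V x := by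
  rintro ⟨x₀, hx₀, hmin⟩
  obtain ⟨C, hC⟩ := hV.1
  obtain ⟨W, hW, hWV⟩ := hC.extend_real
  -- Truncating the extension at `0` makes `u` nonnegative everywhere and, by minimality, changes
  -- nothing on `Ω`.
  set u : EuclideanSpace ℝ (Fin n) → ℝ := fun x => max (W x - V x₀) 0 with hu
  have huL : LipschitzWith C u := by
    have : LipschitzWith (C + 0) fun x => W x - V x₀ := hW.sub (LipschitzWith.const _)
    simpa using this.max_const 0
  have hu0 : ∀ x, 0 ≤ u x := fun x => le_max_right _ _
  have huV : ∀ x ∈ Ω, u x = V x - V x₀ := fun x hx => by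
    rw [hu]
    simp only
    rw [← hWV hx, max_eq_left (sub_nonneg.2 (hmin x hx))]
  have hus := hV.of_eqOn_sub_const hΩ huL huV
  have hopen : IsOpen {x | x ∈ Ω ∧ u x = 0} := by
    rw [isOpen_iff_mem_nhds]
    rintro x ⟨hx, hux⟩
    filter_upwards [hΩ.mem_nhds hx, hus.eventually_eq_zero hn hΩ hν ha_loc ha hq hb hdiv huL hu0
      hx hux] with y hy1 hy2 using ⟨hy1, hy2⟩
  have hopen' : IsOpen {x | u x ≠ 0} := isOpen_ne_fun huL.continuous continuous_const
  apply hV_nonconst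
  refine ⟨V x₀, fun x hx => ?_⟩
  by_contra hne
  have hux : u x ≠ 0 := by rw [huV x hx]; exact sub_ne_zero.2 hne
  obtain ⟨y, -, hy1, hy2⟩ := hΩc.isPreconnected _ _ hopen hopen'
    (fun y hy => by
      by_cases h : u y = 0
      · exact Or.inl ⟨hy, h⟩
      · exact Or.inr h)
    ⟨x₀, hx₀, hx₀, by rw [huV x₀ hx₀, sub_self]⟩ ⟨x, hx, hux⟩
  exact hy2 hy1.2
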